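/- Let $U$ be a compact connected Riemann surface of genus $g\ge 1$, and let $h\colon U\to U$ be an orientation-preserving diffeomorphism such that $1$ is not an eigenvalue of the induced map $h_*\colon H_1(U;\mathbb{C})\to H_1(U;\mathbb{C})$. Let $$U_h = U\times\mathbb{R}\,/\,\big((x,t+1)\sim(h(x),t)\big)$$ be the mapping torus of $h$, and let $p\colon U_h\to S^1=\mathbb{R}/\mathbb{Z}$, $[x,t]\mapsto t \bmod 1$, be its canonical fibration. For a path-connected space $X$ let $\mathbb{T}(X)=\operatorname{Hom}(\pi_1(X),\mathbb{C}^*)$ be its character group (with the topology of pointwise convergence), let $\mathbb{T}^0(X)$ be the connected component of $1$ in $\mathbb{T}(X)$, and let $$\mathcal{V}_1(X)=\{\rho\in\mathbb{T}(X) : \dim_{\mathbb{C}} H^1(X;\mathbb{C}_\rho)\ge 1\},$$ where $\mathbb{C}_\rho$ is the rank one local system on $X$ whose parallel transport along a loop $\gamma$ is multiplication by $\rho(\gamma)$. Base points are taken at $[u,0]\in U_h$, for an arbitrary $u\in U$, and at $0\in S^1$. Then $b_1(U_h)=1$. Evaluation at the standard generator $t\mapsto t \bmod 1$ $(0\le t\le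 1)$ of $\pi_1(S^1)$ is an isomorphism of topological groups $\mathbb{T}(S^1)\cong\mathbb{C}^*$, and $p^*\colon\mathbb{T}(S^1)\to\mathbb{T}(U_h)$ is an isomorphism of topological groups onto $\mathbb{T}^0(U_h)$. Under the resulting identification $\mathbb{T}^0(U_h)\cong\mathbb{C}^*$, the set $\mathcal{V}_1(U_h)\cap\mathbb{T}^0(U_h)\subset\mathbb{C}^*$ consists of $1$ together with the eigenvalues of $h_*$ on $H_1(U;\mathbb{C})$. -/

import Mathlib

open CategoryTheory AlgebraicTopology Topology
open scoped Manifold ContDiff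

noncomputable section

/-! ### First homology, genus, orientations -/

/-- The first singular homology group `H₁(X; ℂ)`. -/
abbrev H1 (X : Type) [TopologicalSpace X] : ModuleCat ℂ :=
  ((singularHomologyFunctor (ModuleCat ℂ) 1).obj (ModuleCat.of ℂ ℂ)).obj (TopCat.of X)

/-- The map `f_* : H₁(X; ℂ) → H₁(Y; ℂ)` induced by a continuous map `f`. -/
abbrev H1map {X Y : Type} [TopologicalSpace X] [TopologicalSpace Y] (f : C(X, Y)) :
    H1 X →ₗ[ℂ] H1 Y :=
  (((singularHomologyFunctor (ModuleCat ℂ) 1).obj (ModuleCat.of ℂ ℂ)).map (TopCat.ofHom f)).hom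

/-- The topological genus: half of the first Betti number. -/
def genus (X : Type) [TopologicalSpace X] : ℕ :=
  Module.finrank ℂ (H1 X) / 2

/-- A map of Riemann surfaces preserves the complex orientations: its real differential,
read in holomorphic charts, has positive determinant at every point. -/
def OrientationPreserving {U V : Type} [TopologicalSpace U] [ChartedSpace ℂ U]
    [TopologicalSpace V] [ChartedSpace ℂ V] (f : U → V) : Prop :=
  ∀ x : U, 0 < ContinuousLinearMap.det
    (show ℂ →L[ℝ] ℂ from mfderiv 𝓘(ℝ, ℂ) 𝓘(ℝ, ℂ) f x)

/-- A connected surface is path connected. -/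
instance pathConnectedSpace_of_chartedSpace_complex {U : Type} [TopologicalSpace U]
    [ChartedSpace ℂ U] [ConnectedSpace U] : PathConnectedSpace U :=
  haveI := ChartedSpace.locallyPathConnectedSpace ℂ U
  pathConnectedSpace_iff_connectedSpace.mpr inferInstance

/-! ### Mapping tori -/

section MappingTorus

variable {X : Type} [TopologicalSpace X]

/-- The equivalence relation on `X × ℝ` generated by `(x, t + 1) ∼ (h x, t)`. -/
def mappingTorusSetoid (h : X ≃ₜ X) : Setoid (X × ℝ) where
  r a b := ∃ n : ℤ, b.1 = (h ^ n) a.1 ∧ a.2 = b.2 + n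
  iseqv :=
    { refl := fun a => ⟨0, by simp, by simp⟩
      symm := by
        rintro a b ⟨n, h1, h2⟩
        refine ⟨-n, ?_, by push_cast; linarith⟩
        rw [h1, ← Homeomorph.mul_apply, ← zpow_add]
        simp
      trans := by
        rintro a b c ⟨n, h1, h2⟩ ⟨m, h3, h4⟩
        refine ⟨m + n, ?_, by push_cast; linarith⟩
        rw [h3, h1, ← Homeomorph.mul_apply, ← zpow_add] }

/-- The mapping torus `X × ℝ / (x, t + 1) ∼ (h x, t)`, that is,
`X × [0, 1] / (x, 1) ∼ (h x, 0)`. -/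
def MappingTorus (h : X ≃ₜ X) : Type :=
  Quotient (mappingTorusSetoid h)

instance (h : X ≃ₜ X) : TopologicalSpace (MappingTorus h) :=
  inferInstanceAs (TopologicalSpace (Quotient (mappingTorusSetoid h)))

/-- The class of `(x, t)` in the mapping torus. -/
def MappingTorus.mk (h : X ≃ₜ X) (a : X × ℝ) : MappingTorus h :=
  Quotient.mk (mappingTorusSetoid h) a

theorem MappingTorus.continuous_mk (h : X ≃ₜ X) : Continuous (MappingTorus.mk h) :=
  continuous_quotient_mk'

theorem MappingTorus.surjective_mk (h : X ≃ₜ X) : Function.Surjective (MappingTorus.mk h) :=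
  Quotient.mk_surjective

instance (h : X ≃ₜ X) [PathConnectedSpace X] : PathConnectedSpace (MappingTorus h) :=
  (MappingTorus.surjective_mk h).pathConnectedSpace (MappingTorus.continuous_mk h)

/-- The canonical fibration `p : X_h → S¹ = ℝ / ℤ`, `[x, t] ↦ t mod 1`. -/
def MappingTorus.proj (h : X ≃ₜ X) : C(MappingTorus h, UnitAddCircle) where
  toFun := Quotient.lift (fun a : X × ℝ => (a.2 : UnitAddCircle)) (by
    rintro a b ⟨n, -, h2⟩
    show (a.2 : UnitAddCircle) = (b.2 : UnitAddCircle)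
    rw [h2, AddCircle.coe_add, add_eq_left, AddCircle.coe_eq_zero_iff]
    exact ⟨n, by simp⟩)
  continuous_toFun := Continuous.quotient_lift
    ((AddCircle.continuous_mk' (1 : ℝ)).comp continuous_snd) _

theorem MappingTorus.proj_mk_zero (h : X ≃ₜ X) (x : X) :
    MappingTorus.proj h (MappingTorus.mk h (x, 0)) = 0 :=
  rfl

end MappingTorus

/-! ### Character groups -/

/-- The character group `𝕋(X) = Hom(π₁(X, x₀), ℂ*)`. -/
def CharacterGroup (X : Type) [TopologicalSpace X] (x₀ : X) : Type :=
  FundamentalGroup X x₀ →* ℂˣ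

instance (X : Type) [TopologicalSpace X] (x₀ : X) : CommGroup (CharacterGroup X x₀) :=
  inferInstanceAs (CommGroup (FundamentalGroup X x₀ →* ℂˣ))

/-- The topology of pointwise convergence. For a finitely generated fundamental group this is
the topology of `𝕋(X)` as a closed subgroup of a torus `(ℂ*)ⁿ`. -/
instance (X : Type) [TopologicalSpace X] (x₀ : X) : TopologicalSpace (CharacterGroup X x₀) :=
  TopologicalSpace.induced
    (fun (ρ : FundamentalGroup X x₀ →* ℂˣ) (g : FundamentalGroup X x₀) => ρ g) inferInstance

/-- The identity component `𝕋⁰(X)`. -/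
def identityComponent (X : Type) [TopologicalSpace X] (x₀ : X) : Set (CharacterGroup X x₀) :=
  connectedComponent 1

/-- The pullback of characters along a pointed continuous map. -/
def CharacterGroup.pullback {X Y : Type} [TopologicalSpace X] [TopologicalSpace Y]
    (f : C(X, Y)) {x₀ : X} {y₀ : Y} (hf : f x₀ = y₀) :
    CharacterGroup Y y₀ →* CharacterGroup X x₀ where
  toFun ρ := MonoidHom.comp ρ (FundamentalGroup.mapOfEq f hf)
  map_one' := rfl
  map_mul' _ _ := rfl

/-- The base point `[x, 0]` of the mapping torus. -/
def MappingTorus.base {X : Type} [TopologicalSpace X] (h : X ≃ₜ X) (x : X) : MappingTorus h :=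
  MappingTorus.mk h (x, 0)

/-- The homomorphism `p^* : 𝕋(S¹) → 𝕋(X_h)` induced by the canonical fibration. -/
def MappingTorus.projPullback {X : Type} [TopologicalSpace X] (h : X ≃ₜ X) (x : X) :
    CharacterGroup UnitAddCircle 0 →* CharacterGroup (MappingTorus h) (MappingTorus.base h x) :=
  CharacterGroup.pullback (MappingTorus.proj h) (MappingTorus.proj_mk_zero h x)

/-- The standard generator `t ↦ t mod 1`, `0 ≤ t ≤ 1`, of `π₁(ℝ / ℤ, 0)`. -/
def circleGenerator : FundamentalGroup UnitAddCircle 0 :=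
  FundamentalGroup.fromPath (Path.Homotopic.Quotient.mk
    { toFun := fun t : unitInterval => ((t : ℝ) : UnitAddCircle)
      continuous_toFun := (AddCircle.continuous_mk' (1 : ℝ)).comp continuous_subtype_val
      source' := by simp
      target' := by simp })

/-- The map `𝕋(S¹) → ℂ*` that evaluates a character at the standard generator. -/
def circleCharacterEval : CharacterGroup UnitAddCircle 0 →* ℂˣ where
  toFun ρ := (show FundamentalGroup UnitAddCircle 0 →* ℂˣ from ρ) circleGenerator
  map_one' := rfl
  map_mul' _ _ := rfl

/-! ### Cohomology with coefficients in a local system -/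

section LocalSystem

/-- A local system of complex vector spaces on `X`: a fibre at every point and, for every
homotopy class of paths from `x` to `y`, a parallel transport from the fibre at `x` to the fibre
at `y`, functorially. -/
abbrev LocalSystem (X : Type) [TopologicalSpace X] : Type 1 :=
  FundamentalGroupoid X ⥤ ModuleCat.{0} ℂ

variable {X : Type} [TopologicalSpace X]

/-- Singular simplices of dimension `n`. -/
abbrev SingularSimplex (X : Type) [TopologicalSpace X] (n : ℕ) : Type :=
  C(stdSimplex ℝ (Fin (n + 1)), X)

/-- The initial vertex of a singular simplex. -/
def SingularSimplex.base {n : ℕ} (σ : SingularSimplex X n) : X :=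
  σ (stdSimplex.vertex 0)

/-- The `i`-th face of a singular simplex. -/
def SingularSimplex.face {n : ℕ} (σ : SingularSimplex X (n + 1)) (i : Fin (n + 2)) :
    SingularSimplex X n :=
  σ.comp ⟨stdSimplex.map i.succAbove, stdSimplex.continuous_map _⟩

/-- The straight path between two points of a simplex. -/
def simplexSegment {n : ℕ} (a b : stdSimplex ℝ (Fin (n + 1))) : Path a b where
  toFun t := ⟨AffineMap.lineMap (a : Fin (n + 1) → ℝ) (b : Fin (n + 1) → ℝ) (t : ℝ),
    (convex_stdSimplex ℝ (Fin (n + 1))).lineMap_mem a.2 b.2 t.2⟩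
  continuous_toFun := by
    refine Continuous.subtype_mk ?_ _
    exact AffineMap.lineMap_continuous.comp continuous_subtype_val
  source' := Subtype.ext (AffineMap.lineMap_apply_zero _ _)
  target' := Subtype.ext (AffineMap.lineMap_apply_one _ _)

/-- Inside the simplex `σ`, the path from the initial vertex of the `i`-th face to the
initial vertex of `σ`. It is constant for `i > 0`. -/
def SingularSimplex.facePath {n : ℕ} (σ : SingularSimplex X (n + 1)) (i : Fin (n + 2)) :
    Path (σ.face i).base σ.base :=
  (simplexSegment (stdSimplex.map i.succAbove (stdSimplex.vertex 0)) (stdSimplex.vertex 0)).map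
    σ.continuous

/-- Singular `n`-cochains with values in `L`: an element of the fibre of `L` at the initial
vertex of each singular `n`-simplex. -/
abbrev TwistedCochain (L : LocalSystem X) (n : ℕ) : Type :=
  ∀ σ : SingularSimplex X n, L.obj (FundamentalGroupoid.mk σ.base)

/-- The coboundary `(δ c)(σ) = ∑ᵢ (-1)ⁱ c(dᵢ σ)`, where `c(dᵢ σ)` is transported to the initial
vertex of `σ`. -/
def twistedCoboundary (L : LocalSystem X) (n : ℕ) :
    TwistedCochain L n →ₗ[ℂ] TwistedCochain L (n + 1) :=
  LinearMap.pi fun σ => ∑ i : Fin (n + 2), (-1 : ℂ) ^ (i : ℕ) •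
    ((L.map (FundamentalGroupoid.fromPath (Path.Homotopic.Quotient.mk (σ.facePath i)))).hom ∘ₗ
      LinearMap.proj (σ.face i))

/-- The first cohomology group `H¹(X; L)`: 1-cocycles modulo 1-coboundaries. -/
abbrev TwistedH1 (L : LocalSystem X) : Type :=
  LinearMap.ker (twistedCoboundary L 1) ⧸
    (LinearMap.range (twistedCoboundary L 0)).submoduleOf (LinearMap.ker (twistedCoboundary L 1))

/-- A chosen homotopy class of paths from `x₀` to `x`. -/
def chosenPath [PathConnectedSpace X] (x₀ : X) (x : FundamentalGroupoid X) :
    FundamentalGroupoid.mk x₀ ⟶ x :=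
  FundamentalGroupoid.fromPath
    (Path.Homotopic.Quotient.mk (PathConnectedSpace.somePath x₀ x.as))

/-- The value of a character at the loop that runs from `x₀` to `x` along the chosen path, then
along `γ` from `x` to `y`, and back to `x₀` along the chosen path. -/
def transportScalar [PathConnectedSpace X] {x₀ : X} (ρ : FundamentalGroup X x₀ →* ℂˣ)
    {x y : FundamentalGroupoid X} (γ : x ⟶ y) : ℂˣ :=
  ρ (FundamentalGroup.fromArrow (chosenPath x₀ x ≫ γ ≫ Groupoid.inv (chosenPath x₀ y)))

theorem transportScalar_id [PathConnectedSpace X] {x₀ : X} (ρ : FundamentalGroup X x₀ →* ℂˣ)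
    (x : FundamentalGroupoid X) : transportScalar ρ (𝟙 x) = 1 := by
  have h : FundamentalGroup.fromArrow
      (chosenPath x₀ x ≫ 𝟙 x ≫ Groupoid.inv (chosenPath x₀ x)) = 1 := by
    rw [Category.id_comp, Groupoid.comp_inv]; rfl
  rw [transportScalar, h, map_one]

theorem transportScalar_comp [PathConnectedSpace X] {x₀ : X} (ρ : FundamentalGroup X x₀ →* ℂˣ)
    {x y z : FundamentalGroupoid X} (γ : x ⟶ y) (γ' : y ⟶ z) :
    transportScalar ρ (γ ≫ γ') = transportScalar ρ γ' * transportScalar ρ γ := by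
  rw [transportScalar, transportScalar, transportScalar, ← map_mul]
  congr 1
  show _ = (chosenPath x₀ x ≫ γ ≫ Groupoid.inv (chosenPath x₀ y)) ≫
    (chosenPath x₀ y ≫ γ' ≫ Groupoid.inv (chosenPath x₀ z))
  simp

/-- The rank one local system `ℂ_ρ`, with its fibres trivialised along the chosen paths: its
parallel transport along a loop at `x₀` is multiplication by the value of `ρ`. -/
def rankOneLocalSystem [PathConnectedSpace X] {x₀ : X} (ρ : CharacterGroup X x₀) :
    LocalSystem X where
  obj _ := ModuleCat.of ℂ ℂ
  map γ := ModuleCat.ofHom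
    (LinearMap.lsmul ℂ ℂ ((transportScalar (show FundamentalGroup X x₀ →* ℂˣ from ρ) γ : ℂˣ) : ℂ))
  map_id x := by
    rw [transportScalar_id]
    ext
    simp
  map_comp γ γ' := by
    rw [transportScalar_comp]
    ext
    simp

/-- The characteristic variety `𝒱_d(X) = {ρ ∈ 𝕋(X) | dim H¹(X; ℂ_ρ) ≥ d}`. -/
def characteristicVariety (X : Type) [TopologicalSpace X] [PathConnectedSpace X] (x₀ : X)
    (d : ℕ) : Set (CharacterGroup X x₀) :=
  {ρ | (d : Cardinal) ≤ Module.rank ℂ (TwistedH1 (rankOneLocalSystem ρ))}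

end LocalSystem

end

/-! The fundamental group `G` of the mapping torus is an extension of `π₁(S¹) = ℤ` by `P = π₁(U)`:
the quotient map from `U × ℝ` is a covering, so `P` injects into `G` and is the kernel of the
projection. The vertical path over the base point, closed up by a path `β` in the fibre, is a lift
`t` of the generator, and conjugation by `t` is the monodromy `θ` on `P`. Products of loops run from
right to left, so the relation reads `θ(a) t = t a`. `MonodromyExtension` records these facts; the
rest is algebra of such extensions.

Homology and cohomology are translated into functions on fundamental groups. `H¹(X; ℂ_ρ)` is nonzero
exactly when there is a nonprincipal crossed homomorphism (`one_le_rank_twistedH1_iff`). Linear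
forms on `H₁(X; ℂ)` are additive functions `π₁(X) → ℂ`, so by duality the eigenvalues of `h_*` are
the `z` with `φ ∘ θ = z φ` for some nonzero additive `φ` on `P` (`hasEigenvalue_H1map_iff`).

An additive function on `G` restricts to a `θ`-invariant one on `P`, which is zero because `1` is
not an eigenvalue. Hence only multiples of the degree remain, and `b₁ = 1`. For the same reason each
`a` in `P` has an `n ≠ 0` with `ρ(a)ⁿ = 1` for all characters `ρ`. Evaluation at `a` is then
constant on the identity component, whose members are therefore trivial on `P` and come from the
circle.

For `ρ` trivial on `P` with `ρ(t) = z`, a crossed homomorphism restricts to an additive `φ` with `φ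
∘ θ = z φ`. If `φ = 0` and `z ≠ 1`, it is principal. Conversely, a nonzero such `φ` extends by `tⁿ a
↦ φ(a)`, and for `z = 1` the degree is not principal (`MonodromyExtension.exists_crossedHom_iff`).
-/

noncomputable section

/-! ### Paths as 1-simplices and edges of simplices -/

section PathsAndSimplices

variable {X : Type} [TopologicalSpace X]

/-- The morphism of the fundamental groupoid represented by a path. -/
abbrev Path.toHom {x y : X} (p : Path x y) :
    FundamentalGroupoid.mk x ⟶ FundamentalGroupoid.mk y :=
  FundamentalGroupoid.fromPath (Path.Homotopic.Quotient.mk p)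

theorem Path.toHom_trans {x y z : X} (p : Path x y) (q : Path y z) :
    (p.trans q).toHom = p.toHom ≫ q.toHom :=
  rfl

theorem Path.toHom_refl (x : X) : (Path.refl x).toHom = 𝟙 (FundamentalGroupoid.mk x) :=
  rfl

theorem Path.toHom_symm {x y : X} (p : Path x y) : p.symm.toHom = Groupoid.inv p.toHom :=
  rfl

theorem exists_path_toHom {x y : FundamentalGroupoid X} (γ : x ⟶ y) :
    ∃ p : Path x.as y.as, p.toHom = γ :=
  Path.Homotopic.Quotient.mk_surjective γ

theorem Path.toHom_eq_of_homotopic {x y : X} {p q : Path x y} (h : p.Homotopic q) :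
    p.toHom = q.toHom :=
  (FundamentalGroupoid.fromPath_eq_iff_homotopic p q).mpr h

/-- A path, seen as a singular 1-simplex. -/
def Path.toSimplex {x y : X} (p : Path x y) : SingularSimplex X 1 :=
  p.toContinuousMap.comp ⟨stdSimplexHomeomorphUnitInterval, by fun_prop⟩

theorem Path.toSimplex_apply {x y : X} (p : Path x y) (s : stdSimplex ℝ (Fin 2)) :
    p.toSimplex s = p (stdSimplexHomeomorphUnitInterval s) :=
  rfl

namespace SingularSimplex

/-- The image under a singular simplex of the edge between two vertices. -/
def edge {n : ℕ} (σ : SingularSimplex X n) (i j : Fin (n + 1)) :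
    Path (σ (stdSimplex.vertex i)) (σ (stdSimplex.vertex j)) :=
  (simplexSegment (stdSimplex.vertex i) (stdSimplex.vertex j)).map σ.continuous

theorem edge_apply {n : ℕ} (σ : SingularSimplex X n) (i j : Fin (n + 1)) (t : unitInterval) :
    σ.edge i j t = σ (simplexSegment (stdSimplex.vertex i) (stdSimplex.vertex j) t) :=
  rfl

theorem simplexSegment_apply {n : ℕ} (a b : stdSimplex ℝ (Fin (n + 1))) (t : unitInterval)
    (i : Fin (n + 1)) : simplexSegment a b t i = (1 - t) * a i + t * b i := by
  show AffineMap.lineMap (a : Fin (n + 1) → ℝ) (b : Fin (n + 1) → ℝ) (t : ℝ) i = _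
  simp [AffineMap.lineMap_apply]
  ring

theorem toSimplex_edge (σ : SingularSimplex X 1) : (σ.edge 0 1).toSimplex = σ := by
  ext s
  rw [Path.toSimplex_apply, edge_apply]
  congr 1
  have h : s 0 + s 1 = 1 := (Fin.sum_univ_two s).symm.trans (stdSimplex.sum_eq_one s)
  have h' : ((stdSimplexHomeomorphUnitInterval s : unitInterval) : ℝ) = s 1 := rfl
  refine stdSimplex.ext (funext fun i => ?_)
  rw [simplexSegment_apply, h']
  fin_cases i
  · simp [eq_sub_of_add_eq h]
  · simp

theorem map_apply {m n : ℕ} (f : Fin (m + 1) → Fin (n + 1)) (s : stdSimplex ℝ (Fin (m + 1)))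
    (i : Fin (n + 1)) :
    stdSimplex.map f s i = ∑ j, if f j = i then s j else 0 := by
  rw [stdSimplex.map_coe, FunOnFinite.linearMap_apply_apply, Finset.sum_filter]

theorem map_simplexSegment (f : Fin 2 → Fin 3) (t : unitInterval) :
    stdSimplex.map f (simplexSegment (stdSimplex.vertex 0) (stdSimplex.vertex 1) t) =
      simplexSegment (stdSimplex.vertex (f 0)) (stdSimplex.vertex (f 1)) t := by
  ext i
  rw [map_apply, simplexSegment_apply, Fin.sum_univ_two, simplexSegment_apply,
    simplexSegment_apply]
  simp [Pi.single_apply, eq_comm]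

theorem face_eq (σ : SingularSimplex X 2) (k : Fin 3) :
    σ.face k = (σ.edge (k.succAbove 0) (k.succAbove 1)).toSimplex := by
  rw [← toSimplex_edge (σ.face k)]
  ext s
  rw [Path.toSimplex_apply, Path.toSimplex_apply, edge_apply, edge_apply]
  exact congrArg σ (map_simplexSegment _ _)

/-- The standard simplex is convex, hence simply connected, so the homotopy exists there and is
pushed forward by `σ`. -/
theorem edge_trans_homotopic {n : ℕ} (σ : SingularSimplex X n) (i j k : Fin (n + 1)) :
    ((σ.edge i j).trans (σ.edge j k)).Homotopic (σ.edge i k) := by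
  have : ContractibleSpace (stdSimplex ℝ (Fin (n + 1))) :=
    (convex_stdSimplex ℝ (Fin (n + 1))).contractibleSpace ⟨_, (stdSimplex.vertex 0).2⟩
  unfold edge
  rw [← Path.map_trans]
  exact (SimplyConnectedSpace.paths_homotopic _ _).map ⟨σ, σ.continuous⟩

theorem edge_symm_homotopic {n : ℕ} (σ : SingularSimplex X n) (i j : Fin (n + 1)) :
    (σ.edge i j).symm.Homotopic (σ.edge j i) := by
  have : ContractibleSpace (stdSimplex ℝ (Fin (n + 1))) :=
    (convex_stdSimplex ℝ (Fin (n + 1))).contractibleSpace ⟨_, (stdSimplex.vertex 0).2⟩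
  unfold edge
  rw [Path.map_symm]
  exact (SimplyConnectedSpace.paths_homotopic _ _).map ⟨σ, σ.continuous⟩

end SingularSimplex

/-- The singular 2-simplex obtained from a map on the square by composition with the map
that sends the vertices to `(a 0, b 0)`, `(a 1, b 1)`, `(a 2, b 2)`. -/
def squareTriangle (a b : Fin 3 → unitInterval) (F : C(unitInterval × unitInterval, X)) :
    SingularSimplex X 2 :=
  F.comp
    { toFun := fun s =>
        (⟨∑ i, s i * a i, Finset.sum_nonneg fun i _ => mul_nonneg (stdSimplex.zero_le s i) (a i).2.1,
          (Finset.sum_le_sum fun i _ => mul_le_of_le_one_right (stdSimplex.zero_le s i) (a i).2.2).trans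
            (stdSimplex.sum_eq_one s).le⟩,
        ⟨∑ i, s i * b i, Finset.sum_nonneg fun i _ => mul_nonneg (stdSimplex.zero_le s i) (b i).2.1,
          (Finset.sum_le_sum fun i _ => mul_le_of_le_one_right (stdSimplex.zero_le s i) (b i).2.2).trans
            (stdSimplex.sum_eq_one s).le⟩)
      continuous_toFun := by
        have h (i : Fin 3) : Continuous fun s : stdSimplex ℝ (Fin 3) => s i :=
          (continuous_apply i).comp continuous_subtype_val
        refine (Continuous.subtype_mk ?_ _).prodMk (Continuous.subtype_mk ?_ _) <;>
          exact continuous_finsetSum _ fun i _ => (h i).mul continuous_const }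

theorem squareTriangle_edge (a b : Fin 3 → unitInterval) (F : C(unitInterval × unitInterval, X))
    (i j : Fin 3) (t u v : unitInterval) (hu : (u : ℝ) = (1 - t) * a i + t * a j)
    (hv : (v : ℝ) = (1 - t) * b i + t * b j) :
    (squareTriangle a b F).edge i j t = F (u, v) := by
  rw [SingularSimplex.edge_apply]
  refine congrArg F (Prod.ext (Subtype.ext ?_) (Subtype.ext ?_))
  · rw [hu]
    show ∑ k, (simplexSegment _ _ t) k * (a k : ℝ) = _
    simp only [SingularSimplex.simplexSegment_apply, stdSimplex.vertex_coe, add_mul,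
      Finset.sum_add_distrib, mul_assoc, ← Finset.mul_sum]
    simp [Pi.single_apply]
  · rw [hv]
    show ∑ k, (simplexSegment _ _ t) k * (b k : ℝ) = _
    simp only [SingularSimplex.simplexSegment_apply, stdSimplex.vertex_coe, add_mul,
      Finset.sum_add_distrib, mul_assoc, ← Finset.mul_sum]
    simp [Pi.single_apply]

end PathsAndSimplices

/-! ### Parallel transport and the coboundary of `ℂ_ρ` in scalar form -/

section TransportScalar

variable {X : Type} [TopologicalSpace X] [PathConnectedSpace X] {x₀ : X}
  (ρ : FundamentalGroup X x₀ →* ℂˣ)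

theorem transportScalar_inv {x y : FundamentalGroupoid X} (γ : x ⟶ y) :
    transportScalar ρ (Groupoid.inv γ) = (transportScalar ρ γ)⁻¹ := by
  rw [eq_inv_iff_mul_eq_one, ← transportScalar_comp, Groupoid.comp_inv, transportScalar_id]

/-- The chosen path from `x₀` to itself need not be constant, so transport evaluates `ρ` at a
conjugate of `g`; commutativity of `ℂˣ` removes the conjugation. -/
theorem transportScalar_loop (g : FundamentalGroup X x₀) :
    transportScalar ρ g.toArrow = ρ g := by
  have h : FundamentalGroup.fromArrow (chosenPath x₀ (FundamentalGroupoid.mk x₀) ≫ g.toArrow ≫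
      Groupoid.inv (chosenPath x₀ (FundamentalGroupoid.mk x₀))) =
      (FundamentalGroup.fromArrow (chosenPath x₀ (FundamentalGroupoid.mk x₀)))⁻¹ * g *
        FundamentalGroup.fromArrow (chosenPath x₀ (FundamentalGroupoid.mk x₀)) := rfl
  rw [transportScalar, h, map_mul, map_mul, map_inv, mul_right_comm, inv_mul_cancel, one_mul]

theorem transportScalar_one {x y : FundamentalGroupoid X} (γ : x ⟶ y) :
    transportScalar (1 : FundamentalGroup X x₀ →* ℂˣ) γ = 1 :=
  rfl

/-- The coboundary transports coefficients towards the initial vertex of `σ`, against the edge `0 →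
j`; hence the inverse. -/
theorem transportScalar_segment {n : ℕ} (σ : SingularSimplex X n)
    {a : stdSimplex ℝ (Fin (n + 1))} (j : Fin (n + 1)) (h : a = stdSimplex.vertex j) :
    transportScalar ρ ((simplexSegment a (stdSimplex.vertex 0)).map σ.continuous).toHom =
      (transportScalar ρ (σ.edge 0 j).toHom)⁻¹ := by
  subst h
  rw [← transportScalar_inv, ← Path.toHom_symm,
    Path.toHom_eq_of_homotopic (σ.edge_symm_homotopic 0 j)]
  rfl

theorem transportScalar_edge_self {n : ℕ} (σ : SingularSimplex X n) (i : Fin (n + 1)) :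
    transportScalar ρ (σ.edge i i).toHom = 1 := by
  have h := congrArg (transportScalar ρ) (Path.toHom_eq_of_homotopic (σ.edge_trans_homotopic i i i))
  rwa [Path.toHom_trans, transportScalar_comp, mul_eq_left] at h

/-- A scalar function on singular simplices, as a cochain with values in `ℂ_ρ`. -/
def scalarCochain {n : ℕ} (c : SingularSimplex X n → ℂ) :
    TwistedCochain (rankOneLocalSystem (x₀ := x₀) ρ) n :=
  c

theorem twistedCoboundary_scalarCochain_sum {n : ℕ} (c : SingularSimplex X n → ℂ) :
    twistedCoboundary _ n (scalarCochain ρ c) = scalarCochain ρ fun σ =>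
      ∑ i : Fin (n + 2), (-1 : ℂ) ^ (i : ℕ) * (((transportScalar ρ (FundamentalGroupoid.fromPath
        (Path.Homotopic.Quotient.mk (σ.facePath i))) : ℂˣ) : ℂ) * c (σ.face i)) := by
  funext σ
  simp only [twistedCoboundary, LinearMap.pi_apply, LinearMap.sum_apply]
  rfl

/-- Only the face opposite to vertex `0` has a different initial vertex, so only its term acquires a
transport factor. -/
theorem twistedCoboundary_one_scalarCochain (c : SingularSimplex X 1 → ℂ) :
    twistedCoboundary _ 1 (scalarCochain ρ c) = scalarCochain ρ fun σ =>
      ((transportScalar ρ (σ.edge 0 1).toHom)⁻¹ : ℂˣ) * c (σ.edge 1 2).toSimplex -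
        c (σ.edge 0 2).toSimplex + c (σ.edge 0 1).toSimplex := by
  rw [twistedCoboundary_scalarCochain_sum]
  congr 1
  funext σ
  have h (i : Fin 3) := transportScalar_segment ρ σ (i.succAbove 0)
    (stdSimplex.map_vertex (S := ℝ) i.succAbove (0 : Fin 2))
  have h' (i : Fin 3) : transportScalar ρ (FundamentalGroupoid.fromPath
      (Path.Homotopic.Quotient.mk (σ.facePath i))) =
      (transportScalar ρ (σ.edge 0 (i.succAbove 0)).toHom)⁻¹ := h i
  rw [Fin.sum_univ_three, h', h', h', σ.face_eq 0, σ.face_eq 1, σ.face_eq 2]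
  have e1 : transportScalar ρ (σ.edge 0 (Fin.succAbove 1 (0 : Fin 2))).toHom = 1 :=
    transportScalar_edge_self ρ σ 0
  have e2 : transportScalar ρ (σ.edge 0 (Fin.succAbove 2 (0 : Fin 2))).toHom = 1 :=
    transportScalar_edge_self ρ σ 0
  rw [e1, e2]
  have f0 : (σ.edge (Fin.succAbove 0 (0 : Fin 2)) (Fin.succAbove 0 (1 : Fin 2))).toSimplex =
    (σ.edge 1 2).toSimplex := rfl
  have f1 : (σ.edge (Fin.succAbove 1 (0 : Fin 2)) (Fin.succAbove 1 (1 : Fin 2))).toSimplex =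
    (σ.edge 0 2).toSimplex := rfl
  have f2 : (σ.edge (Fin.succAbove 2 (0 : Fin 2)) (Fin.succAbove 2 (1 : Fin 2))).toSimplex =
    (σ.edge 0 1).toSimplex := rfl
  rw [f0, f1, f2]
  show (-1 : ℂ) ^ 0 * (((transportScalar ρ (σ.edge 0 1).toHom)⁻¹ : ℂˣ) * _) +
    (-1 : ℂ) ^ 1 * (((1 : ℂˣ)⁻¹ : ℂˣ) * _) + (-1 : ℂ) ^ 2 * (((1 : ℂˣ)⁻¹ : ℂˣ) * _) = _
  simp only [inv_one, Units.val_one]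
  ring

/-- The coboundary of a scalar function on points. -/
theorem twistedCoboundary_zero_scalarCochain (b : X → ℂ) :
    twistedCoboundary _ 0 (scalarCochain ρ fun σ : SingularSimplex X 0 => b σ.base) =
      scalarCochain ρ fun σ => ((transportScalar ρ (σ.edge 0 1).toHom)⁻¹ : ℂˣ) *
        b (σ (stdSimplex.vertex 1)) - b (σ (stdSimplex.vertex 0)) := by
  rw [twistedCoboundary_scalarCochain_sum]
  congr 1
  funext σ
  have h (i : Fin 2) := transportScalar_segment ρ σ (i.succAbove 0)
    (stdSimplex.map_vertex (S := ℝ) i.succAbove (0 : Fin 1))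
  have h' (i : Fin 2) : transportScalar ρ (FundamentalGroupoid.fromPath
      (Path.Homotopic.Quotient.mk (σ.facePath i))) =
      (transportScalar ρ (σ.edge 0 (i.succAbove 0)).toHom)⁻¹ := h i
  have hb (i : Fin 2) : (σ.face i).base = σ (stdSimplex.vertex (i.succAbove 0)) :=
    congrArg σ (stdSimplex.map_vertex (S := ℝ) i.succAbove (0 : Fin 1))
  rw [Fin.sum_univ_two, h', h', hb, hb]
  have e1 : transportScalar ρ (σ.edge 0 (Fin.succAbove 1 (0 : Fin 1))).toHom = 1 :=
    transportScalar_edge_self ρ σ 0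
  rw [e1]
  show (-1 : ℂ) ^ 0 * (((transportScalar ρ (σ.edge 0 1).toHom)⁻¹ : ℂˣ) *
    b (σ (stdSimplex.vertex 1))) +
    (-1 : ℂ) ^ 1 * (((1 : ℂˣ)⁻¹ : ℂˣ) * b (σ (stdSimplex.vertex 0))) = _
  simp only [inv_one, Units.val_one]
  ring

omit [PathConnectedSpace X] in
theorem SingularSimplex.zero_eq_const (σ : SingularSimplex X 0) :
    σ = ContinuousMap.const _ σ.base := by
  ext s
  exact congrArg σ (Subsingleton.elim _ _)

/-- Every 0-cochain is a function on points. -/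
theorem exists_eq_scalarCochain_base (b : TwistedCochain (rankOneLocalSystem (x₀ := x₀) ρ) 0) :
    ∃ f : X → ℂ, b = scalarCochain ρ fun σ => f σ.base := by
  refine ⟨fun x => (show SingularSimplex X 0 → ℂ from b) (ContinuousMap.const _ x), ?_⟩
  funext σ
  exact congrArg (show SingularSimplex X 0 → ℂ from b) σ.zero_eq_const

end TransportScalar

/-! ### Twisted cocycles and crossed homomorphisms -/

section Cocycles

variable {X : Type} [TopologicalSpace X]

/-- Letting `F` range over all pairs of end points makes paths comparable when their end points
agree only propositionally, without casts. -/
theorem Path.toHom_congr {α : Type*} (F : ∀ x y : FundamentalGroupoid X, (x ⟶ y) → α)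
    {x y x' y' : X} {p : Path x y} {p' : Path x' y'} (h : ∀ t, p t = p' t) :
    F _ _ p.toHom = F _ _ p'.toHom := by
  obtain rfl : x = x' := by rw [← p.source, h, p'.source]
  obtain rfl : y = y' := by rw [← p.target, h, p'.target]
  rw [Path.ext (funext h)]

theorem Path.toSimplex_congr {x y x' y' : X} {p : Path x y} {p' : Path x' y'}
    (h : ∀ t, p t = p' t) : p.toSimplex = p'.toSimplex := by
  ext s
  exact h _

theorem Path.edge_toSimplex_apply {x y : X} (p : Path x y) (t : unitInterval) :
    p.toSimplex.edge 0 1 t = p t := by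
  rw [SingularSimplex.edge_apply, Path.toSimplex_apply]
  refine congrArg p (Subtype.ext ?_)
  show (simplexSegment _ _ t) (1 : Fin 2) = (t : ℝ)
  rw [SingularSimplex.simplexSegment_apply]
  simp

variable [PathConnectedSpace X] {x₀ : X} (ρ : FundamentalGroup X x₀ →* ℂˣ)

/-- A function on paths up to homotopy that is a 1-cocycle with values in `ℂ_ρ`. -/
def IsCrossed (F : ∀ x y : FundamentalGroupoid X, (x ⟶ y) → ℂ) : Prop :=
  ∀ {x y z : FundamentalGroupoid X} (γ : x ⟶ y) (δ : y ⟶ z),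
    F _ _ (γ ≫ δ) = F _ _ γ + ((transportScalar ρ γ)⁻¹ : ℂˣ) * F _ _ δ

/-- A scalar function on singular 1-simplices that is a 1-cocycle with values in `ℂ_ρ`. -/
def IsScalarCocycle (c : SingularSimplex X 1 → ℂ) : Prop :=
  ∀ σ : SingularSimplex X 2, c (σ.edge 0 2).toSimplex = c (σ.edge 0 1).toSimplex +
    ((transportScalar ρ (σ.edge 0 1).toHom)⁻¹ : ℂˣ) * c (σ.edge 1 2).toSimplex

theorem scalarCochain_mem_ker_iff (c : SingularSimplex X 1 → ℂ) :
    scalarCochain ρ c ∈ LinearMap.ker (twistedCoboundary (rankOneLocalSystem (x₀ := x₀) ρ) 1) ↔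
      IsScalarCocycle ρ c := by
  rw [LinearMap.mem_ker, twistedCoboundary_one_scalarCochain, IsScalarCocycle]
  refine ⟨fun h σ => ?_, fun h => ?_⟩
  · have := congrFun h σ
    have h' : ((transportScalar ρ (σ.edge 0 1).toHom)⁻¹ : ℂˣ) * c (σ.edge 1 2).toSimplex -
        c (σ.edge 0 2).toSimplex + c (σ.edge 0 1).toSimplex = 0 := this
    linear_combination -h'
  · funext σ
    show ((transportScalar ρ (σ.edge 0 1).toHom)⁻¹ : ℂˣ) * c (σ.edge 1 2).toSimplex -
        c (σ.edge 0 2).toSimplex + c (σ.edge 0 1).toSimplex = (0 : ℂ)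
    rw [h σ]
    ring

theorem IsCrossed.isScalarCocycle {F : ∀ x y : FundamentalGroupoid X, (x ⟶ y) → ℂ}
    (hF : IsCrossed ρ F) : IsScalarCocycle ρ fun σ => F _ _ (σ.edge 0 1).toHom := by
  intro σ
  have h (i j : Fin 3) : F _ _ ((σ.edge i j).toSimplex.edge 0 1).toHom = F _ _ (σ.edge i j).toHom :=
    Path.toHom_congr F (Path.edge_toSimplex_apply _)
  show F _ _ _ = F _ _ _ + _ * F _ _ _
  rw [h, h, h, ← Path.toHom_eq_of_homotopic (σ.edge_trans_homotopic 0 1 2), Path.toHom_trans, hF]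

namespace IsScalarCocycle

variable {ρ} {c : SingularSimplex X 1 → ℂ} (hc : IsScalarCocycle ρ c)
include hc

theorem triangle (σ : SingularSimplex X 2) {x y z x' y' z' : X} {p : Path x y} {q : Path y' z}
    {r : Path x' z'} (hp : ∀ t, σ.edge 0 1 t = p t) (hq : ∀ t, σ.edge 1 2 t = q t)
    (hr : ∀ t, σ.edge 0 2 t = r t) :
    c r.toSimplex = c p.toSimplex + ((transportScalar ρ p.toHom)⁻¹ : ℂˣ) * c q.toSimplex := by
  rw [← Path.toSimplex_congr hp, ← Path.toSimplex_congr hq, ← Path.toSimplex_congr hr, hc σ,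
    Path.toHom_congr (fun _ _ => transportScalar ρ) hp]

theorem refl (x : X) : c (Path.refl x).toSimplex = 0 := by
  have h := hc.triangle (ContinuousMap.const _ x) (p := Path.refl x) (q := Path.refl x)
    (r := Path.refl x) (fun _ => rfl) (fun _ => rfl) fun _ => rfl
  rw [Path.toHom_refl, transportScalar_id] at h
  simpa using h

/-- The 2-simplex is flattened onto the interval with vertices at `0`, `1/2`, `1` and mapped by
`p.trans q`; its edges are `p`, `q` and the concatenation. -/
theorem trans {x y z : X} (p : Path x y) (q : Path y z) :
    c (p.trans q).toSimplex =
      c p.toSimplex + ((transportScalar ρ p.toHom)⁻¹ : ℂˣ) * c q.toSimplex := by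
  let h2 : unitInterval := ⟨1 / 2, by norm_num, by norm_num⟩
  refine hc.triangle (squareTriangle ![0, h2, 1] 0
    ((p.trans q).toContinuousMap.comp ContinuousMap.fst)) (fun t => ?_) (fun t => ?_) fun t => ?_
  · have ht : (t : ℝ) / 2 ≤ 1 / 2 := by linarith [t.2.2]
    have ht' : (t : ℝ) / 2 ∈ unitInterval := ⟨by linarith [t.2.1], by linarith⟩
    rw [squareTriangle_edge _ _ _ 0 1 t ⟨t / 2, ht'⟩ 0 (by simp [h2]; ring) (by simp)]
    show (p.trans q) ⟨t / 2, ht'⟩ = p t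
    rw [Path.trans_apply, dif_pos ht]
    congr 1
    ext
    simp
    ring
  · have ht' : (1 + t : ℝ) / 2 ∈ unitInterval := ⟨by linarith [t.2.1], by linarith [t.2.2]⟩
    rw [squareTriangle_edge _ _ _ 1 2 t ⟨(1 + t) / 2, ht'⟩ 0 (by simp [h2]; ring) (by simp)]
    show (p.trans q) ⟨(1 + t) / 2, ht'⟩ = q t
    rw [Path.trans_apply]
    split_ifs with h
    · have h0 : t = 0 := by
        ext
        have := t.2.1
        simp only [Set.Icc.coe_zero]
        change (1 + (t : ℝ)) / 2 ≤ 1 / 2 at h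
        linarith
      subst h0
      rw [q.source]
      convert p.target
      simp
    · congr 1
      ext
      simp
      ring
  · rw [squareTriangle_edge _ _ _ 0 2 t t 0 (by simp) (by simp)]
    rfl

/-- The diagonal `r` cuts the square of the homotopy into two triangles. Each has a constant edge,
on which `c` vanishes, so `c p = c r = c q`. -/
theorem eq_of_homotopic {x y : X} {p q : Path x y} (h : p.Homotopic q) :
    c p.toSimplex = c q.toSimplex := by
  obtain ⟨H⟩ := h
  have hr (z : X) : transportScalar ρ (Path.refl z).toHom = 1 := by
    rw [Path.toHom_refl, transportScalar_id]
  let r : Path x y :=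
    { toFun := fun t => H (t, t)
      continuous_toFun := by fun_prop
      source' := by simp
      target' := by simp }
  have h1 := hc.triangle (squareTriangle ![0, 0, 1] ![0, 1, 1] H.toContinuousMap) (p := p)
    (q := Path.refl y) (r := r)
    (fun t => by
      rw [squareTriangle_edge _ _ _ 0 1 t 0 t (by simp) (by simp)]
      exact H.apply_zero t)
    (fun t => by
      rw [squareTriangle_edge _ _ _ 1 2 t t 1 (by simp) (by simp)]
      exact H.target t)
    (fun t => by
      rw [squareTriangle_edge _ _ _ 0 2 t t t (by simp) (by simp)]
      rfl)
  have h2 := hc.triangle (squareTriangle ![0, 1, 1] ![0, 0, 1] H.toContinuousMap)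
    (p := Path.refl x) (q := q) (r := r)
    (fun t => by
      rw [squareTriangle_edge _ _ _ 0 1 t t 0 (by simp) (by simp)]
      exact H.source t)
    (fun t => by
      rw [squareTriangle_edge _ _ _ 1 2 t 1 t (by simp) (by simp)]
      exact H.apply_one t)
    (fun t => by
      rw [squareTriangle_edge _ _ _ 0 2 t t t (by simp) (by simp)]
      rfl)
  rw [hc.refl] at h1 h2
  rw [hr] at h2
  simpa using h1.symm.trans h2

/-- A cocycle depends only on the homotopy class of a path. -/
theorem exists_isCrossed : ∃ F : ∀ x y : FundamentalGroupoid X, (x ⟶ y) → ℂ,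
    IsCrossed ρ F ∧ ∀ σ, c σ = F _ _ (σ.edge 0 1).toHom := by
  let F : ∀ x y : FundamentalGroupoid X, (x ⟶ y) → ℂ :=
    fun _ _ γ => c (exists_path_toHom γ).choose.toSimplex
  have hF {x y : X} (p : Path x y) : F _ _ p.toHom = c p.toSimplex :=
    hc.eq_of_homotopic ((FundamentalGroupoid.fromPath_eq_iff_homotopic _ _).mp
      (exists_path_toHom p.toHom).choose_spec)
  refine ⟨F, fun γ δ => ?_, fun σ => ?_⟩
  · obtain ⟨p, rfl⟩ := exists_path_toHom γ
    obtain ⟨q, rfl⟩ := exists_path_toHom δ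
    exact (hF (p.trans q)).trans (by rw [hc.trans, hF, hF])
  · rw [hF, SingularSimplex.toSimplex_edge]

end IsScalarCocycle

/-- A cocycle on the fundamental groupoid that is principal on the fundamental group is a
coboundary. -/
theorem IsCrossed.exists_coboundary {F : ∀ x y : FundamentalGroupoid X, (x ⟶ y) → ℂ}
    (hF : IsCrossed ρ F) {v : ℂ}
    (hv : ∀ g : FundamentalGroup X x₀, F _ _ g.toArrow = v * (((ρ g)⁻¹ : ℂˣ) - 1)) :
    ∃ b : X → ℂ, ∀ {x y : FundamentalGroupoid X} (γ : x ⟶ y),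
      F _ _ γ = ((transportScalar ρ γ)⁻¹ : ℂˣ) * b y.as - b x.as := by
  -- The required identity along the chosen path from `x₀` to `x`, together with `b x₀ = v`, forces
  -- this formula.
  refine ⟨fun x => transportScalar ρ (chosenPath x₀ (.mk x)) *
    (F _ _ (chosenPath x₀ (.mk x)) + v), fun {x y} γ => ?_⟩
  let g : FundamentalGroup X x₀ :=
    FundamentalGroup.fromArrow (chosenPath x₀ x ≫ γ ≫ Groupoid.inv (chosenPath x₀ y))
  have hg : chosenPath x₀ x ≫ γ = g.toArrow ≫ chosenPath x₀ y := by
    simp [g]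
  have h1 := congrArg (F _ _) hg
  have h2 := congrArg (transportScalar ρ) hg
  rw [hF, hF, hv] at h1
  rw [transportScalar_comp, transportScalar_comp, transportScalar_loop] at h2
  have h3 := congrArg Units.val h2
  rw [Units.val_mul, Units.val_mul] at h3
  rw [← transportScalar_loop] at h1 h3
  simp only [Units.val_inv_eq_inv_val] at h1 ⊢
  set A := ((transportScalar ρ (chosenPath x₀ x) : ℂˣ) : ℂ) with hA
  set B := ((transportScalar ρ (chosenPath x₀ y) : ℂˣ) : ℂ) with hB
  set T := ((transportScalar ρ γ : ℂˣ) : ℂ) with hT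
  set G := ((transportScalar ρ g.toArrow : ℂˣ) : ℂ) with hG
  have hA0 : A ≠ 0 := Units.ne_zero _
  have hB0 : B ≠ 0 := Units.ne_zero _
  have hT0 : T ≠ 0 := Units.ne_zero _
  have hG0 : G ≠ 0 := Units.ne_zero _
  have hGi : G⁻¹ = T⁻¹ * B * A⁻¹ := by
    field_simp
    linear_combination h3
  rw [hGi] at h1
  show F _ _ γ = T⁻¹ * (B * (F _ _ (chosenPath x₀ y) + v)) - A * (F _ _ (chosenPath x₀ x) + v)
  have h4 := congrArg (A * ·) h1
  simp only [mul_add, mul_sub, ← mul_assoc, mul_inv_cancel₀ hA0, one_mul] at h4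
  have h5 : A * v * T⁻¹ * B * A⁻¹ = v * T⁻¹ * B := by field_simp
  have h6 : A * T⁻¹ * B * A⁻¹ = T⁻¹ * B := by field_simp
  rw [h5, h6] at h4
  linear_combination h4

/-- A crossed homomorphism on the fundamental group extends to the fundamental groupoid. -/
theorem exists_isCrossed_of_crossedHom {f : FundamentalGroup X x₀ → ℂ}
    (hf : ∀ a b, f (a * b) = f b + ((ρ b)⁻¹ : ℂˣ) * f a) :
    ∃ F : ∀ x y : FundamentalGroupoid X, (x ⟶ y) → ℂ, IsCrossed ρ F ∧
      ∃ k : FundamentalGroup X x₀, ∀ g : FundamentalGroup X x₀,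
        F _ _ g.toArrow = f (k⁻¹ * g * k) := by
  -- Each path is closed up by the chosen paths. Since the one at `x₀` is possibly a nontrivial loop
  -- `k`, the function `f` is recovered only up to conjugation by `k`.
  refine ⟨fun x y γ => f (FundamentalGroup.fromArrow
    (chosenPath x₀ x ≫ γ ≫ Groupoid.inv (chosenPath x₀ y))), fun {x y z} γ δ => ?_,
    FundamentalGroup.fromArrow (chosenPath x₀ (FundamentalGroupoid.mk x₀)), fun g => rfl⟩
  have h : FundamentalGroup.fromArrow
      (chosenPath x₀ x ≫ (γ ≫ δ) ≫ Groupoid.inv (chosenPath x₀ z)) =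
      FundamentalGroup.fromArrow (chosenPath x₀ y ≫ δ ≫ Groupoid.inv (chosenPath x₀ z)) *
      FundamentalGroup.fromArrow (chosenPath x₀ x ≫ γ ≫ Groupoid.inv (chosenPath x₀ y)) := by
    show _ = (chosenPath x₀ x ≫ γ ≫ Groupoid.inv (chosenPath x₀ y)) ≫
      (chosenPath x₀ y ≫ δ ≫ Groupoid.inv (chosenPath x₀ z))
    simp
  exact (congrArg f h).trans (hf _ _)

/-- The first cohomology of `ℂ_ρ` is nonzero if and only if the fundamental group has a crossed
homomorphism with values in `ℂ_ρ` that is not principal. -/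
theorem one_le_rank_twistedH1_iff :
    1 ≤ Module.rank ℂ (TwistedH1 (rankOneLocalSystem (x₀ := x₀) ρ)) ↔
      ∃ f : FundamentalGroup X x₀ → ℂ, (∀ a b, f (a * b) = f b + ((ρ b)⁻¹ : ℂˣ) * f a) ∧
        ¬ ∃ v : ℂ, ∀ a, f a = v * (((ρ a)⁻¹ : ℂˣ) - 1) := by
  rw [Cardinal.one_le_iff_pos, rank_pos_iff_nontrivial, Submodule.Quotient.nontrivial_iff, ne_eq,
    Submodule.submoduleOf_eq_top, SetLike.not_le_iff_exists]
  constructor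
  · rintro ⟨c, hc, hc'⟩
    change SingularSimplex X 1 → ℂ at c
    obtain ⟨F, hF, hcF⟩ := ((scalarCochain_mem_ker_iff ρ c).mp hc).exists_isCrossed
    refine ⟨fun g => F _ _ g.toArrow, fun a b => ?_, ?_⟩
    · rw [← transportScalar_loop]
      exact hF b.toArrow a.toArrow
    · rintro ⟨v, hv⟩
      obtain ⟨b, hb⟩ := hF.exists_coboundary ρ hv
      refine hc' ⟨scalarCochain ρ fun σ => b σ.base, ?_⟩
      rw [twistedCoboundary_zero_scalarCochain]
      funext σ
      exact ((hcF σ).trans (hb _)).symm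
  · rintro ⟨f, hf, hf'⟩
    obtain ⟨F, hF, k, hk⟩ := exists_isCrossed_of_crossedHom ρ hf
    refine ⟨scalarCochain ρ fun σ => F _ _ (σ.edge 0 1).toHom,
      (scalarCochain_mem_ker_iff ρ _).mpr hF.isScalarCocycle, ?_⟩
    rintro ⟨b, hb⟩
    obtain ⟨b, rfl⟩ := exists_eq_scalarCochain_base ρ b
    rw [twistedCoboundary_zero_scalarCochain] at hb
    refine hf' ⟨b x₀, fun a => ?_⟩
    -- Conjugating by `k` undoes the conjugation in `hk`, so `F` takes the value `f a` here, while
    -- `ρ` does not see it.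
    obtain ⟨p, hp⟩ := exists_path_toHom (FundamentalGroup.toArrow (k * a * k⁻¹))
    have h1 : ((transportScalar ρ (p.toSimplex.edge 0 1).toHom)⁻¹ : ℂˣ) *
        b (p.toSimplex (stdSimplex.vertex 1)) - b (p.toSimplex (stdSimplex.vertex 0)) =
        F _ _ (p.toSimplex.edge 0 1).toHom := congrFun hb p.toSimplex
    rw [Path.toHom_congr F (Path.edge_toSimplex_apply p),
      Path.toHom_congr (fun _ _ => transportScalar ρ) (Path.edge_toSimplex_apply p), hp, hk,
      transportScalar_loop] at h1
    have e0 : p.toSimplex (stdSimplex.vertex 0) = x₀ := p.source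
    have e1 : p.toSimplex (stdSimplex.vertex 1) = x₀ := p.target
    have e2 : k⁻¹ * (k * a * k⁻¹) * k = a := by group
    have e3 : ρ (k * a * k⁻¹) = ρ a := by
      rw [map_mul, map_mul, map_inv, mul_right_comm, mul_inv_cancel, one_mul]
    rw [e0, e1, e2, e3] at h1
    rw [← h1]
    ring

end Cocycles

/-! ### Linear forms on `H₁` as additive functions on loops -/

section FirstHomology

open Opposite Simplicial

variable (X : Type) [TopologicalSpace X]

/-- The singular chain complex of `X` with complex coefficients. -/
abbrev singularChains : ChainComplex (ModuleCat ℂ) ℕ :=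
  (TopCat.toSSet.obj (TopCat.of X)).chainComplex (ModuleCat.of ℂ ℂ)

variable {X}

/-- The generator of the singular chains given by a singular simplex. -/
def SingularSimplex.chain {n : ℕ} (σ : SingularSimplex X n) :
    ModuleCat.of ℂ ℂ ⟶ (singularChains X).X n :=
  (TopCat.toSSet.obj (TopCat.of X)).ιChainComplex
    ((TopCat.toSSetObjEquiv (TopCat.of X) (op ⦋n⦌)).symm σ)

theorem singularChains_hom_ext {n : ℕ} {M : ModuleCat ℂ} {f g : (singularChains X).X n ⟶ M}
    (h : ∀ σ : SingularSimplex X n, σ.chain ≫ f = σ.chain ≫ g) : f = g := by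
  refine SSet.chainComplex_hom_ext fun x => ?_
  have := h (TopCat.toSSetObjEquiv (TopCat.of X) (op ⦋n⦌) x)
  rwa [SingularSimplex.chain, Equiv.symm_apply_apply] at this

theorem SingularSimplex.chain_d {n : ℕ} (σ : SingularSimplex X (n + 1)) :
    σ.chain ≫ (singularChains X).d (n + 1) n =
      ∑ i : Fin (n + 2), (-1 : ℤ) ^ (i : ℕ) • (σ.face i).chain :=
  SSet.ιChainComplex_d _ _ _

/-- The linear map on singular chains with prescribed values on singular simplices. -/
def chainsDesc {n : ℕ} (c : SingularSimplex X n → ℂ) :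
    (singularChains X).X n ⟶ ModuleCat.of ℂ ℂ :=
  Limits.Cofan.IsColimit.desc ((TopCat.toSSet.obj (TopCat.of X)).isColimitChainComplexXCofan
    (ModuleCat.of ℂ ℂ) n) fun x => ModuleCat.ofHom
      (LinearMap.lsmul ℂ ℂ (c (TopCat.toSSetObjEquiv (TopCat.of X) (op ⦋n⦌) x)))

theorem SingularSimplex.chain_chainsDesc {n : ℕ} (c : SingularSimplex X n → ℂ)
    (σ : SingularSimplex X n) :
    σ.chain ≫ chainsDesc c = ModuleCat.ofHom (LinearMap.lsmul ℂ ℂ (c σ)) := by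
  refine (Limits.Cofan.IsColimit.fac _ _ _).trans ?_
  rw [Equiv.apply_symm_apply]

theorem SingularSimplex.chain_map {Y : Type} [TopologicalSpace Y] (f : C(X, Y)) {n : ℕ}
    (σ : SingularSimplex X n) :
    σ.chain ≫ (SSet.chainComplexMap (TopCat.toSSet.map (TopCat.ofHom f))
      (ModuleCat.of ℂ ℂ)).f n = SingularSimplex.chain (X := Y) (f.comp σ) :=
  SSet.ι_chainComplexMap_f _ _ _ _ _

/-- Untwisted cocycles are the case `ρ = 1` of the twisted ones, so the results on crossed functions
also apply to ordinary homology. -/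
theorem d_comp_chainsDesc_eq_zero_iff [PathConnectedSpace X] {x₀ : X}
    (c : SingularSimplex X 1 → ℂ) :
    (singularChains X).d 2 1 ≫ chainsDesc c = 0 ↔
      IsScalarCocycle (1 : FundamentalGroup X x₀ →* ℂˣ) c := by
  have key (σ : SingularSimplex X 2) : σ.chain ≫ (singularChains X).d 2 1 ≫ chainsDesc c =
      ModuleCat.ofHom (LinearMap.lsmul ℂ ℂ (c (σ.edge 1 2).toSimplex - c (σ.edge 0 2).toSimplex +
        c (σ.edge 0 1).toSimplex)) := by
    have f0 : σ.face 0 = (σ.edge 1 2).toSimplex := σ.face_eq 0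
    have f1 : σ.face 1 = (σ.edge 0 2).toSimplex := σ.face_eq 1
    have f2 : σ.face 2 = (σ.edge 0 1).toSimplex := σ.face_eq 2
    rw [← Category.assoc, SingularSimplex.chain_d, Fin.sum_univ_three, f0, f1, f2]
    simp only [Preadditive.add_comp, Preadditive.zsmul_comp, SingularSimplex.chain_chainsDesc]
    ext
    simp
    ring
  have one (σ : SingularSimplex X 2) :
      (((transportScalar (1 : FundamentalGroup X x₀ →* ℂˣ) (σ.edge 0 1).toHom)⁻¹ : ℂˣ) : ℂ) = 1 := by
    rw [transportScalar_one, inv_one, Units.val_one]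
  constructor
  · intro h σ
    have h1 := key σ
    rw [h, Limits.comp_zero] at h1
    have h2 : (0 : ℂ) = (c (σ.edge 1 2).toSimplex - c (σ.edge 0 2).toSimplex +
        c (σ.edge 0 1).toSimplex) * 1 := congrArg (fun g => g.hom (1 : ℂ)) h1
    rw [one]
    linear_combination h2
  · intro h
    refine singularChains_hom_ext fun σ => ?_
    rw [key, h σ, one, Limits.comp_zero]
    ext
    simp

theorem eq_chainsDesc {n : ℕ} (f : (singularChains X).X n ⟶ ModuleCat.of ℂ ℂ) :
    f = chainsDesc fun σ => (σ.chain ≫ f).hom (1 : ℂ) := by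
  refine singularChains_hom_ext fun σ => ?_
  rw [SingularSimplex.chain_chainsDesc]
  ext
  simp

theorem SingularSimplex.face_zero_eq (σ : SingularSimplex X 1) :
    σ.face 0 = ContinuousMap.const _ (σ (stdSimplex.vertex 1)) := by
  rw [SingularSimplex.zero_eq_const (σ.face 0)]
  exact congrArg _ (congrArg σ (stdSimplex.map_vertex (S := ℝ) (Fin.succAbove 0) (0 : Fin 1)))

theorem SingularSimplex.face_one_eq (σ : SingularSimplex X 1) :
    σ.face 1 = ContinuousMap.const _ (σ (stdSimplex.vertex 0)) := by
  rw [SingularSimplex.zero_eq_const (σ.face 1)]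
  exact congrArg _ (congrArg σ (stdSimplex.map_vertex (S := ℝ) (Fin.succAbove 1) (0 : Fin 1)))

theorem SingularSimplex.chain_d_one (σ : SingularSimplex X 1) :
    σ.chain ≫ (singularChains X).d 1 0 = (σ.face 0).chain - (σ.face 1).chain := by
  rw [SingularSimplex.chain_d, Fin.sum_univ_two]
  simp [sub_eq_add_neg]

theorem Path.toSimplex_chain_d {x : X} (p : Path x x) :
    p.toSimplex.chain ≫ (singularChains X).d 1 0 = 0 := by
  have e0 : p.toSimplex (stdSimplex.vertex 0) = x := p.source
  have e1 : p.toSimplex (stdSimplex.vertex 1) = x := p.target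
  rw [SingularSimplex.chain_d_one, SingularSimplex.face_zero_eq, SingularSimplex.face_one_eq,
    e0, e1, sub_self]

/-- The class of a loop in the first homology group. -/
def loopClass {x : X} (p : Path x x) : H1 X :=
  ((singularChains X).liftCycles p.toSimplex.chain 0 (ChainComplex.next_nat_succ 0)
    p.toSimplex_chain_d ≫ (singularChains X).homologyπ 1).hom (1 : ℂ)

theorem H1map_loopClass {Y : Type} [TopologicalSpace Y] (f : C(X, Y)) {x : X} (p : Path x x) :
    H1map f (loopClass p) = loopClass (p.map f.continuous) := by
  have h : ((singularChains X).liftCycles p.toSimplex.chain 0 (ChainComplex.next_nat_succ 0)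
      p.toSimplex_chain_d ≫ (singularChains X).homologyπ 1) ≫
      HomologicalComplex.homologyMap (SSet.chainComplexMap (TopCat.toSSet.map (TopCat.ofHom f))
        (ModuleCat.of ℂ ℂ)) 1 =
      (singularChains Y).liftCycles (p.map f.continuous).toSimplex.chain 0
        (ChainComplex.next_nat_succ 0) (p.map f.continuous).toSimplex_chain_d ≫
        (singularChains Y).homologyπ 1 := by
    rw [Category.assoc, HomologicalComplex.homologyπ_naturality, ← Category.assoc,
      HomologicalComplex.liftCycles_comp_cyclesMap]
    congr 2
    exact p.toSimplex.chain_map f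
  exact congrArg (fun g => g.hom (1 : ℂ)) h

theorem homologyι_apply_loopClass {x : X} (p : Path x x) (c : SingularSimplex X 1 → ℂ)
    (ψ : (singularChains X).opcycles 1 ⟶ ModuleCat.of ℂ ℂ)
    (hψ : (singularChains X).pOpcycles 1 ≫ ψ = chainsDesc c) :
    ((singularChains X).homologyι 1 ≫ ψ).hom (loopClass p) = c p.toSimplex := by
  have h : ((singularChains X).liftCycles p.toSimplex.chain 0 (ChainComplex.next_nat_succ 0)
      p.toSimplex_chain_d ≫ (singularChains X).homologyπ 1) ≫ (singularChains X).homologyι 1 ≫ ψ =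
      ModuleCat.ofHom (LinearMap.lsmul ℂ ℂ (c p.toSimplex)) := by
    rw [Category.assoc, HomologicalComplex.homology_π_ι_assoc, hψ,
      HomologicalComplex.liftCycles_i_assoc, SingularSimplex.chain_chainsDesc]
  exact (congrArg (fun g => g.hom (1 : ℂ)) h).trans (mul_one _)

/-- Every linear form on the first homology group is given by a cocycle. -/
theorem exists_chainsDesc (ψ : H1 X →ₗ[ℂ] ℂ) :
    ∃ (c : SingularSimplex X 1 → ℂ) (ψ' : (singularChains X).opcycles 1 ⟶ ModuleCat.of ℂ ℂ),
      (singularChains X).pOpcycles 1 ≫ ψ' = chainsDesc c ∧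
      ψ = ((singularChains X).homologyι 1 ≫ ψ').hom := by
  -- Homology embeds in chains modulo boundaries; over a field the embedding splits, so the form
  -- extends.
  obtain ⟨r, hr⟩ := ((singularChains X).homologyι 1).hom.exists_leftInverse_of_injective
    (LinearMap.ker_eq_bot.mpr ((ModuleCat.mono_iff_injective _).mp inferInstance))
  refine ⟨_, ModuleCat.ofHom ((show (singularChains X).homology 1 →ₗ[ℂ] ℂ from ψ) ∘ₗ r),
    eq_chainsDesc _, ?_⟩
  ext v
  exact (congrArg ψ (congrArg (fun f => f v) hr)).symm

variable [PathConnectedSpace X] {x₀ : X}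

/-- A homomorphism from the fundamental group to `ℂ` factors through the first homology group. -/
theorem exists_dual_loopClass {φ : FundamentalGroup X x₀ → ℂ}
    (hφ : ∀ a b, φ (a * b) = φ a + φ b) :
    ∃ ψ : H1 X →ₗ[ℂ] ℂ, ∀ p : Path x₀ x₀,
      ψ (loopClass p) = φ (FundamentalGroup.fromArrow p.toHom) := by
  have hφ' (a b) : φ (a * b) = φ b +
      (((1 : FundamentalGroup X x₀ →* ℂˣ) b)⁻¹ : ℂˣ) * φ a := by
    rw [hφ, add_comm]
    simp
  obtain ⟨F, hF, k, hk⟩ := exists_isCrossed_of_crossedHom 1 hφ'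
  let c : SingularSimplex X 1 → ℂ := fun σ => F _ _ (σ.edge 0 1).toHom
  have hc := (d_comp_chainsDesc_eq_zero_iff (x₀ := x₀) c).mpr hF.isScalarCocycle
  have hprev : (ComplexShape.down ℕ).prev 1 = 2 := ChainComplex.prev ℕ 1
  refine ⟨((singularChains X).homologyι 1 ≫
    (singularChains X).descOpcycles (chainsDesc c) 2 hprev hc).hom, fun p => ?_⟩
  refine (homologyι_apply_loopClass p c _ (HomologicalComplex.p_descOpcycles _ _ _ _ _)).trans ?_
  show F _ _ _ = _
  rw [Path.toHom_congr F (Path.edge_toSimplex_apply p)]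
  refine (hk (FundamentalGroup.fromArrow p.toHom)).trans ?_
  have h1 : φ 1 = 0 := by simpa using hφ 1 1
  have h2 : φ k⁻¹ + φ k = 0 := by rw [← hφ, inv_mul_cancel, h1]
  rw [hφ, hφ]
  linear_combination h2

/-- A linear form on the first homology group is given on loops by an additive function on
paths. -/
theorem exists_isCrossed_loopClass (x₀ : X) (ψ : H1 X →ₗ[ℂ] ℂ) :
    ∃ F : ∀ x y : FundamentalGroupoid X, (x ⟶ y) → ℂ,
      IsCrossed (1 : FundamentalGroup X x₀ →* ℂˣ) F ∧
      ∀ {x : X} (p : Path x x), ψ (loopClass p) = F _ _ p.toHom := by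
  obtain ⟨c, ψ', hc, rfl⟩ := exists_chainsDesc ψ
  have hc' : IsScalarCocycle (1 : FundamentalGroup X x₀ →* ℂˣ) c := by
    rw [← d_comp_chainsDesc_eq_zero_iff, ← hc, HomologicalComplex.d_pOpcycles_assoc,
      Limits.zero_comp]
  obtain ⟨F, hF, hcF⟩ := hc'.exists_isCrossed
  refine ⟨F, hF, fun p => ?_⟩
  refine (homologyι_apply_loopClass p c ψ' hc).trans ?_
  rw [hcF, Path.toHom_congr F (Path.edge_toSimplex_apply p)]

/-- The classes of loops span the first homology group. -/
theorem dual_eq_zero_of_loopClass (ψ : H1 X →ₗ[ℂ] ℂ)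
    (h : ∀ p : Path x₀ x₀, ψ (loopClass p) = 0) : ψ = 0 := by
  obtain ⟨c, ψ', hc, rfl⟩ := exists_chainsDesc ψ
  have hc' : IsScalarCocycle (1 : FundamentalGroup X x₀ →* ℂˣ) c := by
    rw [← d_comp_chainsDesc_eq_zero_iff, ← hc, HomologicalComplex.d_pOpcycles_assoc,
      Limits.zero_comp]
  obtain ⟨F, hF, hcF⟩ := hc'.exists_isCrossed
  -- Vanishing on loops is principality with `v = 0`; the cocycle is then a coboundary and kills all
  -- cycles.
  have hv (g : FundamentalGroup X x₀) : F _ _ g.toArrow =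
      0 * ((((1 : FundamentalGroup X x₀ →* ℂˣ) g)⁻¹ : ℂˣ) - 1) := by
    obtain ⟨p, hp⟩ := exists_path_toHom g.toArrow
    rw [zero_mul, ← hp, ← Path.toHom_congr F (Path.edge_toSimplex_apply p), ← hcF]
    exact (homologyι_apply_loopClass p c ψ' hc).symm.trans (h p)
  obtain ⟨b, hb⟩ := hF.exists_coboundary _ hv
  have hcb : chainsDesc c = (singularChains X).d 1 0 ≫
      chainsDesc fun σ : SingularSimplex X 0 => b σ.base := by
    refine singularChains_hom_ext fun σ => ?_
    rw [← Category.assoc, SingularSimplex.chain_d_one, Preadditive.sub_comp,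
      SingularSimplex.chain_chainsDesc, SingularSimplex.chain_chainsDesc,
      SingularSimplex.chain_chainsDesc, SingularSimplex.face_zero_eq,
      SingularSimplex.face_one_eq, hcF, hb, transportScalar_one, inv_one, Units.val_one, one_mul]
    ext
    simp [SingularSimplex.base]
  have h0 : (singularChains X).homologyπ 1 ≫ (singularChains X).homologyι 1 ≫ ψ' = 0 := by
    rw [HomologicalComplex.homology_π_ι_assoc, hc, hcb, HomologicalComplex.iCycles_d_assoc,
      Limits.zero_comp]
  rw [Limits.zero_of_epi_comp _ h0]
  rfl

end FirstHomology

/-! ### The fundamental group of the circle is infinite cyclic -/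

section CircleFundamentalGroup

/-- The straight path from `0` to `1`, which lifts the standard generator. -/
def unitPath : Path (0 : ℝ) 1 where
  toFun t := t
  continuous_toFun := continuous_subtype_val
  source' := rfl
  target' := rfl

/-- The fundamental group of the circle, as the deck group of the line. -/
def circleFundamentalGroupEquiv :
    FundamentalGroup UnitAddCircle 0 ≃* (Multiplicative (AddSubgroup.zmultiples (1 : ℝ)))ᵐᵒᵖ :=
  (AddCircle.isAddQuotientCoveringMap_coe (1 : ℝ)).fundamentalGroupEquiv
    (x := (0 : UnitAddCircle)) ⟨0, rfl⟩

/-- The lift of the generator from `0` is the unit path, which ends at `1`; so its deck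
transformation is translation by `1`. -/
theorem circleFundamentalGroupEquiv_generator :
    circleFundamentalGroupEquiv circleGenerator =
      MulOpposite.op (Multiplicative.ofAdd ⟨1, AddSubgroup.mem_zmultiples 1⟩) := by
  refine (IsAddQuotientCoveringMap.fundamentalGroupToMulOpposite_apply_eq_Iff
    (AddCircle.isAddQuotientCoveringMap_coe (1 : ℝ))).mpr ?_
  have h1 : ((1 : ℝ) : UnitAddCircle) = 0 := AddCircle.coe_period 1
  have h := (AddCircle.isCoveringMap_coe (1 : ℝ)).monodromy_eq_of_map_eq
    (γ := circleGenerator.toPath) (ex := ⟨0, rfl⟩) (ey := ⟨1, h1⟩)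
    (Path.Homotopic.Quotient.mk unitPath) rfl
  refine Eq.trans ?_ (congrArg Subtype.val h).symm
  show (1 : ℝ) + 0 = 1
  norm_num

theorem circleFundamentalGroupEquiv_generator_zpow (n : ℤ) :
    circleFundamentalGroupEquiv (circleGenerator ^ n) =
      MulOpposite.op (Multiplicative.ofAdd (n • ⟨1, AddSubgroup.mem_zmultiples 1⟩)) := by
  rw [map_zpow, circleFundamentalGroupEquiv_generator, ← MulOpposite.op_zpow, ofAdd_zsmul]

theorem exists_circleGenerator_zpow (g : FundamentalGroup UnitAddCircle 0) :
    ∃ n : ℤ, circleGenerator ^ n = g := by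
  obtain ⟨n, hn⟩ := AddSubgroup.mem_zmultiples_iff.mp
    (circleFundamentalGroupEquiv g).unop.toAdd.2
  refine ⟨n, circleFundamentalGroupEquiv.injective ?_⟩
  rw [circleFundamentalGroupEquiv_generator_zpow]
  refine MulOpposite.unop_injective (Multiplicative.toAdd.injective (Subtype.ext ?_))
  exact (by simp : _ = n • (1 : ℝ)).trans hn

theorem circleGenerator_zpow_injective :
    Function.Injective fun n : ℤ => circleGenerator ^ n := by
  intro n m h
  have h' := congrArg circleFundamentalGroupEquiv h
  simp only [circleFundamentalGroupEquiv_generator_zpow] at h'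
  have h2 := congrArg (fun x => ((Multiplicative.toAdd (MulOpposite.unop x) :
    AddSubgroup.zmultiples (1 : ℝ)) : ℝ)) h'
  simpa using h2

end CircleFundamentalGroup

/-! ### The fundamental group of the mapping torus as an extension -/

namespace MappingTorus

variable {X : Type} [TopologicalSpace X] (h : X ≃ₜ X)

theorem mk_eq_mk_iff {a b : X × ℝ} :
    mk h a = mk h b ↔ ∃ n : ℤ, b.1 = (h ^ n) a.1 ∧ a.2 = b.2 + n :=
  Quotient.eq

/-- The action of `ℤ` on `X × ℝ` with quotient the mapping torus. -/
@[reducible]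
def deckAction : AddAction ℤ (X × ℝ) where
  vadd n a := ((h ^ (-n)) a.1, a.2 + n)
  zero_vadd a := by
    show ((h ^ (-(0 : ℤ))) a.1, a.2 + ((0 : ℤ) : ℝ)) = a
    simp
  add_vadd m n a := by
    show ((h ^ (-(m + n))) a.1, a.2 + ((m + n : ℤ) : ℝ)) =
      ((h ^ (-m)) ((h ^ (-n)) a.1), a.2 + n + m)
    rw [← Homeomorph.mul_apply, ← zpow_add, neg_add]
    push_cast
    rw [add_comm (m : ℝ), add_assoc]

/-- The integer `n` moves the real coordinate by `n`, so a slab of width `1` is disjoint from its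
nontrivial translates. -/
theorem isCoveringMap_mk : IsCoveringMap (mk h) := by
  let := deckAction h
  have hv (n : ℤ) (a : X × ℝ) : n +ᵥ a = ((h ^ (-n)) a.1, a.2 + n) := rfl
  have : IsAddQuotientCoveringMap (mk h) ℤ :=
    { toIsQuotientMap := isQuotientMap_quotient_mk'
      continuous_const_vadd := fun n => by
        simp only [hv]
        exact ((h ^ (-n)).continuous.comp continuous_fst).prodMk
          (continuous_snd.add continuous_const)
      apply_eq_iff_mem_orbit := fun {a b} => by
        rw [mk_eq_mk_iff]
        refine exists_congr fun n => ?_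
        simp only [hv]
        rw [Prod.ext_iff]
        refine and_congr ⟨fun e => ?_, fun e => ?_⟩ eq_comm
        · rw [e, ← Homeomorph.mul_apply, ← zpow_add]
          simp
        · rw [← e, ← Homeomorph.mul_apply, ← zpow_add]
          simp
      disjoint := fun a => by
        refine ⟨Prod.snd ⁻¹' Metric.ball a.2 (1 / 2),
          continuous_snd.continuousAt.preimage_mem_nhds (Metric.ball_mem_nhds _ (by norm_num)), ?_⟩
        rintro n ⟨_, ⟨b, hb, rfl⟩, hb'⟩
        simp only [hv, Set.mem_preimage, Metric.mem_ball, Real.dist_eq, abs_lt] at hb hb'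
        have h1 : (n : ℝ) < 1 := by linarith [hb.1, hb'.2]
        have h2 : (-1 : ℝ) < n := by linarith [hb.2, hb'.1]
        have h1' : n < 1 := by exact_mod_cast h1
        have h2' : -1 < n := by exact_mod_cast h2
        omega }
  exact this.isCoveringMap

/-- The inclusion of the fibre `x ↦ [x, 0]`. -/
def fiberIncl : C(X, MappingTorus h) where
  toFun x := mk h (x, 0)
  continuous_toFun := (continuous_mk h).comp (continuous_id.prodMk continuous_const)

variable (u : X)

/-- The map of fundamental groups induced by the inclusion of the fibre. -/
def fiberHom : FundamentalGroup X u →* FundamentalGroup (MappingTorus h) (base h u) :=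
  FundamentalGroup.map (fiberIncl h) u

/-- The map of fundamental groups induced by the fibration. -/
def projHom : FundamentalGroup (MappingTorus h) (base h u) →* FundamentalGroup UnitAddCircle 0 :=
  FundamentalGroup.mapOfEq (proj h) (proj_mk_zero h u)

/-- Loops in the fibre lift to `X × {0}`. A covering is injective on homotopy classes of paths, and
the first projection then returns to `X`. -/
theorem fiberHom_injective : Function.Injective (fiberHom h u) := by
  intro a b hab
  have key : Path.Homotopic.Quotient.map a.toPath ⟨fun x : X => (x, (0 : ℝ)), by fun_prop⟩ =
      Path.Homotopic.Quotient.map b.toPath ⟨fun x : X => (x, (0 : ℝ)), by fun_prop⟩ := by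
    refine (isCoveringMap_mk h).injective_path_homotopic_map (u, (0 : ℝ)) (u, (0 : ℝ)) ?_
    obtain ⟨p, rfl⟩ := Path.Homotopic.Quotient.mk_surjective a
    obtain ⟨q, rfl⟩ := Path.Homotopic.Quotient.mk_surjective b
    exact hab
  have h2 := congrArg (fun γ => Path.Homotopic.Quotient.map γ ⟨Prod.fst, continuous_fst⟩) key
  obtain ⟨p, rfl⟩ := Path.Homotopic.Quotient.mk_surjective a
  obtain ⟨q, rfl⟩ := Path.Homotopic.Quotient.mk_surjective b
  exact h2

theorem projHom_toHom (p : Path (base h u) (base h u)) :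
    projHom h u (FundamentalGroup.fromArrow p.toHom) =
      FundamentalGroup.fromArrow (Path.toHom (x := (0 : UnitAddCircle)) (y := 0)
        (p.map (proj h).continuous)) :=
  FundamentalGroup.mapOfEq_apply _ _ _

theorem projHom_fiberHom (a : FundamentalGroup X u) : projHom h u (fiberHom h u a) = 1 := by
  obtain ⟨p, rfl⟩ := exists_path_toHom a.toArrow
  exact projHom_toHom h u (p.map (fiberIncl h).continuous)

/-- Lift the loop to `X × ℝ`. The real coordinate lifts a null-homotopic loop of the circle, so it
returns to `0` and the lift is itself a loop. Contracting that coordinate pushes it into the fibre.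
-/
theorem exists_fiberHom_eq_of_projHom_eq_one {g : FundamentalGroup (MappingTorus h) (base h u)}
    (hg : projHom h u g = 1) : ∃ a, fiberHom h u a = g := by
  obtain ⟨p, rfl⟩ := exists_path_toHom g.toArrow
  rw [projHom_toHom] at hg
  have hp : (Path.map p (proj h).continuous).Homotopic (Path.refl (0 : UnitAddCircle)) :=
    (FundamentalGroupoid.fromPath_eq_iff_homotopic _ _).mp hg
  let cov := isCoveringMap_mk h
  let covS := AddCircle.isCoveringMap_coe (1 : ℝ)
  have h0 : p.toContinuousMap 0 = mk h (u, 0) := p.source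
  let Γ := cov.liftPath p.toContinuousMap (u, 0) h0
  have hΓ (t) : mk h (Γ t) = p t := congrFun (cov.liftPath_lifts p.toContinuousMap (u, 0) h0) t
  have hΓ0 : Γ 0 = (u, 0) := cov.liftPath_zero p.toContinuousMap (u, 0) h0
  have hs0 : (p.map (proj h).continuous).toContinuousMap 0 = ((0 : ℝ) : UnitAddCircle) :=
    (p.map (proj h).continuous).source
  have hs : (ContinuousMap.snd.comp Γ : C(unitInterval, ℝ)) =
      covS.liftPath (p.map (proj h).continuous).toContinuousMap 0 hs0 := by
    rw [IsCoveringMap.eq_liftPath_iff']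
    refine ⟨funext fun t => ?_, congrArg Prod.snd hΓ0⟩
    exact congrArg (proj h) (hΓ t)
  have hs1 : (Γ 1).2 = 0 := by
    have e1 := congrArg (fun f : C(unitInterval, ℝ) => f 1) hs
    refine e1.trans ?_
    rw [covS.liftPath_apply_one_eq_of_homotopicRel hp 0 hs0 rfl]
    exact congrArg (fun f : C(unitInterval, ℝ) => f 1)
      (covS.liftPath_const (x := (0 : UnitAddCircle)) (e := (0 : ℝ)) rfl)
  have hΓ1 : Γ 1 = (u, 0) := by
    have e1 : mk h (Γ 1) = mk h (u, 0) := (hΓ 1).trans p.target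
    obtain ⟨n, hn1, hn2⟩ := (mk_eq_mk_iff h).mp e1
    rw [hs1, zero_add] at hn2
    have hn : n = 0 := by exact_mod_cast hn2.symm
    subst hn
    exact Prod.ext hn1.symm hs1
  let G : Path (u, (0 : ℝ)) (u, (0 : ℝ)) := ⟨Γ, hΓ0, hΓ1⟩
  let a : Path u u := G.map continuous_fst
  have hG : G.Homotopic (a.prod (Path.refl 0)) := by
    have e1 : G = a.prod (G.map continuous_snd) := rfl
    rw [e1]
    obtain ⟨H⟩ := SimplyConnectedSpace.paths_homotopic (G.map continuous_snd) (Path.refl (0 : ℝ))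
    exact ⟨Path.Homotopic.prodHomotopy (Path.Homotopy.refl a) H⟩
  refine ⟨FundamentalGroup.fromArrow a.toHom, ?_⟩
  have e2 : (G.map (continuous_mk h)) = p := Path.ext (funext hΓ)
  have e3 := Path.toHom_eq_of_homotopic (hG.map ⟨mk h, continuous_mk h⟩)
  exact e3.symm.trans (congrArg Path.toHom e2)

/-- The vertical path `t ↦ [x, t]` from `[x, 0]` to `[h x, 0]`. -/
def verticalPath (x : X) : Path (fiberIncl h x) (fiberIncl h (h x)) where
  toFun t := mk h (x, t)
  continuous_toFun := (continuous_mk h).comp (continuous_const.prodMk continuous_subtype_val)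
  source' := rfl
  target' := (mk_eq_mk_iff h).mpr ⟨1, by simp, by simp⟩

theorem _root_.Path.trans_cast_cast {Y : Type} [TopologicalSpace Y] {x y y' z z' : Y} (p : Path x y)
    (q : Path y z) (hy : y' = y) (hz : z' = z) :
    (p.trans q).cast rfl hz = (p.cast rfl hy).trans (q.cast hy hz) := by
  subst hy hz
  rfl

/-- Pushing a loop in the fibre along the vertical path applies the monodromy. -/
theorem toHom_comp_verticalPath {x y : X} (a : Path x y) :
    (a.map (fiberIncl h).continuous).toHom ≫ (verticalPath h y).toHom =
      (verticalPath h x).toHom ≫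
        ((a.map h.continuous).map (fiberIncl h).continuous).toHom := by
  have hE (z : X) : fiberIncl h (h z) = mk h (z, 1) :=
    ((mk_eq_mk_iff h).mpr ⟨1, by simp, by simp⟩).symm
  -- The two ways around the square `a × [0, 1]` are homotopic in the product; at height `1` the
  -- gluing turns `a` into `h ∘ a`.
  have e1 : ((a.prod (Path.refl (0 : ℝ))).trans ((Path.refl y).prod unitPath)).Homotopic
      (((Path.refl x).prod unitPath).trans (a.prod (Path.refl (1 : ℝ)))) := by
    rw [Path.trans_prod_eq_prod_trans, Path.trans_prod_eq_prod_trans]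
    obtain ⟨H1⟩ := (Path.Homotopic.trans_refl a).trans (Path.Homotopic.refl_trans a).symm
    obtain ⟨H2⟩ := SimplyConnectedSpace.paths_homotopic ((Path.refl (0 : ℝ)).trans unitPath)
      (unitPath.trans (Path.refl 1))
    exact ⟨Path.Homotopic.prodHomotopy H1 H2⟩
  have e2 := (e1.map ⟨mk h, continuous_mk h⟩).pathCast rfl (hE y)
  rw [Path.map_trans, Path.map_trans, Path.trans_cast_cast _ _ rfl (hE y),
    Path.trans_cast_cast _ _ (hE x) (hE y)] at e2
  have e3 := Path.toHom_eq_of_homotopic e2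
  have e4 : (((a.prod (Path.refl (1 : ℝ))).map (continuous_mk h)).cast (hE x) (hE y)) =
      (a.map h.continuous).map (fiberIncl h).continuous := by
    ext t
    exact (hE (a t)).symm
  refine Eq.trans (Eq.trans ?_ e3) ?_
  · rfl
  · exact congrArg (fun q => (verticalPath h x).toHom ≫ Path.toHom q) e4

variable {u} (β : Path (h u) u)

/-- The automorphism of the fundamental group of the fibre induced by the monodromy, with the
base point moved back along `β`. -/
def monodromyHom : FundamentalGroup X u →* FundamentalGroup X u :=
  (FundamentalGroup.fundamentalGroupMulEquivOfPath β).toMonoidHom.comp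
    (FundamentalGroup.map (h : C(X, X)) u)

theorem monodromyHom_toHom (a : Path u u) :
    monodromyHom h β (FundamentalGroup.fromArrow a.toHom) = FundamentalGroup.fromArrow
      (Groupoid.inv β.toHom ≫ (a.map h.continuous).toHom ≫ β.toHom) :=
  rfl

/-- The loop that follows the vertical path and returns along `β`. -/
def monodromyLoop : FundamentalGroup (MappingTorus h) (base h u) :=
  FundamentalGroup.fromArrow (X := MappingTorus h) (x := base h u)
    ((verticalPath h u).toHom ≫ (β.map (fiberIncl h).continuous).toHom)

theorem fiberHom_monodromyHom_mul (a : FundamentalGroup X u) :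
    fiberHom h u (monodromyHom h β a) * monodromyLoop h β =
      monodromyLoop h β * fiberHom h u a := by
  obtain ⟨p, rfl⟩ := exists_path_toHom a.toArrow
  have e1 : fiberHom h u (monodromyHom h β (FundamentalGroup.fromArrow p.toHom)) =
      FundamentalGroup.fromArrow (X := MappingTorus h) (x := base h u)
        (Groupoid.inv (β.map (fiberIncl h).continuous).toHom ≫
        ((p.map h.continuous).map (fiberIncl h).continuous).toHom ≫
        (β.map (fiberIncl h).continuous).toHom) := by
    rw [monodromyHom_toHom]
    have m1 := (FundamentalGroupoid.map (fiberIncl h)).map_comp (Groupoid.inv β.toHom)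
      ((p.map h.continuous).toHom ≫ β.toHom)
    have m2 := (FundamentalGroupoid.map (fiberIncl h)).map_comp (p.map h.continuous).toHom β.toHom
    rw [m2] at m1
    exact m1
  have e2 := toHom_comp_verticalPath h p
  have e3 : ((verticalPath h u).toHom ≫ (β.map (fiberIncl h).continuous).toHom) ≫
      Groupoid.inv (β.map (fiberIncl h).continuous).toHom ≫
        ((p.map h.continuous).map (fiberIncl h).continuous).toHom ≫
        (β.map (fiberIncl h).continuous).toHom =
      (p.map (fiberIncl h).continuous).toHom ≫ (verticalPath h u).toHom ≫
        (β.map (fiberIncl h).continuous).toHom := by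
    rw [← Category.assoc (p.map (fiberIncl h).continuous).toHom, e2]
    simp
  refine Eq.trans (congrArg (· * monodromyLoop h β) e1) ?_
  exact e3

/-- The vertical path projects to the generator, and the return along `β` to a constant path. -/
theorem projHom_monodromyLoop : projHom h u (monodromyLoop h β) = circleGenerator := by
  have e1 := projHom_toHom h u
    ((verticalPath h u).trans (β.map (fiberIncl h).continuous))
  have e2 := Path.map_trans (verticalPath h u) (β.map (fiberIncl h).continuous)
    (proj h).continuous
  refine e1.trans ((congrArg Path.toHom e2).trans ?_)
  exact Category.comp_id (X := FundamentalGroupoid.mk (0 : UnitAddCircle))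
    (Y := FundamentalGroupoid.mk (0 : UnitAddCircle)) circleGenerator.toArrow

end MappingTorus

/-! ### Characters and crossed homomorphisms of cyclic extensions -/

section GroupExtensions

variable {P G C : Type*} [Group P] [Group G] [Group C]

/-- A group extension of the infinite cyclic group generated by `γ` by `P`, with a lift `t` of
the generator that acts on `P` through `θ`. -/
structure MonodromyExtension (i : P →* G) (p : G →* C) (γ : C) (t : G) (θ : P →* P) : Prop where
  injective : Function.Injective i
  proj_incl : ∀ a, p (i a) = 1
  exact : ∀ g, p g = 1 → ∃ a, i a = g
  zpow_injective : Function.Injective fun n : ℤ => γ ^ n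
  zpow_surjective : Function.Surjective fun n : ℤ => γ ^ n
  proj_lift : p t = γ
  comm : ∀ a, i (θ a) * t = t * i a

/-- A character of an infinite cyclic group with a prescribed value at the generator. -/
theorem exists_hom_apply_generator {γ : C} (hinj : Function.Injective fun n : ℤ => γ ^ n)
    (hsurj : Function.Surjective fun n : ℤ => γ ^ n) {A : Type*} [Group A] (z : A) :
    ∃ χ : C →* A, χ γ = z := by
  let e : Multiplicative ℤ ≃* C := MulEquiv.ofBijective (zpowersHom C γ)
    ⟨fun m n h => hinj h, fun c => hsurj c⟩
  refine ⟨(zpowersHom A z).comp e.symm.toMonoidHom, ?_⟩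
  have h : e (Multiplicative.ofAdd 1) = γ := zpow_one γ
  have h' : e.symm γ = Multiplicative.ofAdd 1 := by rw [← h, MulEquiv.symm_apply_apply]
  show zpowersHom A z (e.symm γ) = z
  rw [h']
  exact zpow_one z

namespace MonodromyExtension

variable {i : P →* G} {p : G →* C} {γ : C} {t : G} {θ : P →* P}
  (E : MonodromyExtension i p γ t θ)
include E

theorem exists_eq_zpow_mul (g : G) : ∃ (n : ℤ) (a : P), g = t ^ n * i a := by
  obtain ⟨n, hn⟩ := E.zpow_surjective (p g)
  obtain ⟨a, ha⟩ := E.exact (t ^ (-n) * g) (by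
    have hn' : γ ^ n = p g := hn
    rw [map_mul, map_zpow, E.proj_lift, ← hn', zpow_neg, inv_mul_cancel])
  exact ⟨n, a, by rw [ha, ← mul_assoc, ← zpow_add]; simp⟩

theorem proj_zpow_mul (n : ℤ) (a : P) : p (t ^ n * i a) = γ ^ n := by
  rw [map_mul, map_zpow, E.proj_lift, E.proj_incl, mul_one]

theorem zpow_mul_inj {n m : ℤ} {a b : P} (h : t ^ n * i a = t ^ m * i b) : n = m ∧ a = b := by
  have h1 := congrArg p h
  rw [E.proj_zpow_mul, E.proj_zpow_mul] at h1
  obtain rfl := E.zpow_injective h1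
  exact ⟨rfl, E.injective (mul_left_cancel h)⟩

/-- The kernel of `p` is normal, so `t⁻¹ b t` lies in `P` again. In particular `θ` is surjective. -/
theorem exists_comm (b : P) : ∃ a, θ a = b ∧ i b * t = t * i a := by
  obtain ⟨a, ha⟩ := E.exact (t⁻¹ * i b * t) (by
    rw [map_mul, map_mul, E.proj_incl, mul_one, map_inv, inv_mul_cancel])
  have h : i b * t = t * i a := by rw [ha]; group
  exact ⟨a, E.injective (mul_right_cancel ((E.comm a).trans h.symm)), h⟩

/-- A character that is trivial on `P` factors through the cyclic quotient. -/
theorem exists_comp_eq {A : Type*} [Group A] (χ : G →* A) (hχ : ∀ a, χ (i a) = 1) :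
    ∃ χ' : C →* A, χ'.comp p = χ := by
  obtain ⟨χ', h⟩ := exists_hom_apply_generator E.zpow_injective E.zpow_surjective (χ t)
  refine ⟨χ', MonoidHom.ext fun g => ?_⟩
  obtain ⟨n, a, rfl⟩ := E.exists_eq_zpow_mul g
  rw [MonoidHom.comp_apply, E.proj_zpow_mul, map_zpow, h, map_mul, hχ, mul_one, map_zpow]

theorem conj_invariant {f : G → ℂ} (hf : ∀ a b, f (a * b) = f a + f b) (a : P) :
    f (i (θ a)) = f (i a) := by
  have h := congrArg f (E.comm a)
  rw [hf, hf] at h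
  linear_combination h

/-- The degree, as an additive function. -/
theorem exists_degree : ∃ d : G → ℂ, (∀ a b, d (a * b) = d a + d b) ∧ d t = 1 ∧
    ∀ a, d (i a) = 0 := by
  obtain ⟨χ, hχ⟩ := exists_hom_apply_generator E.zpow_injective E.zpow_surjective
    (Multiplicative.ofAdd (1 : ℂ))
  refine ⟨fun g => (χ (p g)).toAdd, fun a b => ?_, ?_, fun a => ?_⟩
  · simp only [map_mul, toAdd_mul]
  · simp only [E.proj_lift, hχ, toAdd_ofAdd]
  · simp only [E.proj_incl, map_one, toAdd_one]

/-- An additive function that vanishes on `P` is determined by its value at `t`. -/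
theorem eq_smul_degree {d f : G → ℂ} (hd : ∀ a b, d (a * b) = d a + d b) (hdt : d t = 1)
    (hdi : ∀ a, d (i a) = 0) (hf : ∀ a b, f (a * b) = f a + f b) (hfi : ∀ a, f (i a) = 0) (g : G) :
    f g = f t * d g := by
  let F : G →* Multiplicative ℂ := MonoidHom.mk' (fun g => Multiplicative.ofAdd (f g - f t * d g))
    fun a b => by
      rw [← ofAdd_add, hf, hd]
      congr 1
      ring
  have hF : F g = 1 := by
    obtain ⟨n, a, rfl⟩ := E.exists_eq_zpow_mul g
    have h1 : F t = 1 := by simp [F, hdt]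
    have h2 : F (i a) = 1 := by simp [F, hdi, hfi]
    rw [map_mul, map_zpow, h1, h2, one_zpow, one_mul]
  have h3 : f g - f t * d g = 0 := hF
  linear_combination h3

omit E in
/-- An element of infinite order in an abelian group is detected by a homomorphism to `ℂ`. -/
theorem exists_addMonoidHom_ne_zero {A : Type*} [AddCommGroup A] {x : A}
    (hx : ∀ n : ℕ, n ≠ 0 → n • x ≠ 0) : ∃ f : A →+ ℂ, f x ≠ 0 := by
  have hinj : Function.Injective (LinearMap.toSpanSingleton ℤ A x) := by
    rw [← LinearMap.ker_eq_bot, LinearMap.ker_eq_bot']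
    intro m hm
    by_contra hm0
    refine hx m.natAbs (by simpa using hm0) ?_
    rcases Int.natAbs_eq m with h | h
    · rw [LinearMap.toSpanSingleton_apply, h] at hm
      exact_mod_cast hm
    · rw [LinearMap.toSpanSingleton_apply, h, neg_smul, neg_eq_zero] at hm
      exact_mod_cast hm
  -- `ℂ` is flat over `ℤ`, so the copy of `ℤ` spanned by `x` stays injective in `ℂ ⊗ A`. Thus `1 ⊗ x
  -- ≠ 0`, and a complex linear form detects it.
  have hflat := Module.Flat.lTensor_preserves_injective_linearMap (M := ℂ)
    (LinearMap.toSpanSingleton ℤ A x) hinj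
  have hne : (1 : ℂ) ⊗ₜ[ℤ] x ≠ 0 := by
    intro h0
    have h1 : LinearMap.lTensor ℂ (LinearMap.toSpanSingleton ℤ A x) ((1 : ℂ) ⊗ₜ[ℤ] (1 : ℤ)) =
        LinearMap.lTensor ℂ (LinearMap.toSpanSingleton ℤ A x) 0 := by
      rw [LinearMap.lTensor_tmul, LinearMap.toSpanSingleton_apply, one_smul, h0, map_zero]
    have h2 := congrArg (TensorProduct.rid ℤ ℂ) (hflat h1)
    rw [TensorProduct.rid_tmul, one_smul, map_zero] at h2
    exact one_ne_zero h2
  obtain ⟨f, hf⟩ := Module.Projective.exists_dual_ne_zero ℂ hne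
  exact ⟨f.toAddMonoidHom.comp ((TensorProduct.mk ℤ ℂ A 1).toAddMonoidHom), hf⟩

/-- If `θ` fixes no nonzero additive function on `P`, the elements of `P` have finite order in
every abelian quotient of `G`. -/
theorem exists_pow_eq_one
    (hθ : ∀ φ : P → ℂ, (∀ a b, φ (a * b) = φ a + φ b) → (∀ a, φ (θ a) = φ a) → ∀ a, φ a = 0)
    (a : P) : ∃ n : ℕ, n ≠ 0 ∧ ∀ ρ : G →* ℂˣ, ρ (i a) ^ n = 1 := by
  by_contra! hcon
  -- Otherwise characters show that `i a` has infinite order in the abelianization. An additive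
  -- function nonzero at `i a` then restricts to a `θ`-invariant one on `P`, which must vanish.
  obtain ⟨f, hf⟩ := exists_addMonoidHom_ne_zero
    (x := Additive.ofMul (Abelianization.of (i a))) fun n hn h0 => by
      obtain ⟨ρ, hρ⟩ := hcon n hn
      refine hρ ?_
      have h1 : (Abelianization.of (i a)) ^ n = 1 := h0
      have h2 := congrArg (Abelianization.lift ρ) h1
      rwa [map_pow, Abelianization.lift_apply_of, map_one] at h2
  let F : G → ℂ := fun g => f (Additive.ofMul (Abelianization.of g))
  have hF (a b) : F (a * b) = F a + F b := by
    simp only [F, map_mul, ofMul_mul, map_add]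
  exact hf (hθ (fun a => F (i a)) (fun a b => by rw [map_mul, hF])
    (fun a => E.conj_invariant hF a) a)

/-- Moving `a` to the right past `t` replaces it by its preimage under `θ`, which divides `φ` by
`z`; past `t⁻¹` it becomes `θ a`, which multiplies `φ` by `z`. -/
theorem exists_mul_zpow_eq {φ : P → ℂ} {z : ℂˣ} (hφ : ∀ a, φ (θ a) = z * φ a) (m : ℤ) (a : P) :
    ∃ b, i a * t ^ m = t ^ m * i b ∧ φ a = ((z ^ m : ℂˣ) : ℂ) * φ b := by
  induction m with
  | zero => exact ⟨a, by simp, by simp⟩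
  | succ m ih =>
    obtain ⟨b, hb, hb'⟩ := ih
    obtain ⟨c, rfl, hc⟩ := E.exists_comm b
    refine ⟨c, ?_, ?_⟩
    · rw [zpow_add_one, ← mul_assoc, hb, mul_assoc, hc, mul_assoc]
    · rw [hb', hφ, zpow_add_one, Units.val_mul, mul_assoc]
  | pred m ih =>
    obtain ⟨b, hb, hb'⟩ := ih
    refine ⟨θ b, ?_, ?_⟩
    · have h : i b * t⁻¹ = t⁻¹ * i (θ b) := by
        rw [mul_inv_eq_iff_eq_mul, mul_assoc, E.comm, inv_mul_cancel_left]
      rw [zpow_sub_one, ← mul_assoc, hb, mul_assoc, h, mul_assoc]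
    · rw [hb', hφ, zpow_sub_one, Units.val_mul, mul_assoc, Units.inv_mul_cancel_left]

/-- An eigenfunction of `θ` extends to a crossed homomorphism. -/
theorem exists_crossedHom {ρ : G →* ℂˣ} (hρ : ∀ a, ρ (i a) = 1) {φ : P → ℂ}
    (hadd : ∀ a b, φ (a * b) = φ a + φ b) (hφ : ∀ a, φ (θ a) = ρ t * φ a) :
    ∃ f : G → ℂ, (∀ a b, f (a * b) = f b + ((ρ b)⁻¹ : ℂˣ) * f a) ∧ ∀ a, f (i a) = φ a := by
  choose N A hNA using E.exists_eq_zpow_mul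
  have hA (n : ℤ) (a : P) : A (t ^ n * i a) = a := (E.zpow_mul_inj (hNA (t ^ n * i a))).2.symm
  -- Elements have a unique normal form `tⁿ a`, and the extension ignores `tⁿ`.
  refine ⟨fun g => φ (A g), fun g k => ?_, fun a => ?_⟩
  · obtain ⟨n, a, rfl⟩ := E.exists_eq_zpow_mul g
    obtain ⟨m, b, rfl⟩ := E.exists_eq_zpow_mul k
    obtain ⟨c, hc, hc'⟩ := E.exists_mul_zpow_eq hφ m a
    have h : t ^ n * i a * (t ^ m * i b) = t ^ (n + m) * i (c * b) := by
      rw [map_mul, zpow_add, mul_assoc, ← mul_assoc (i a), hc]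
      simp only [mul_assoc]
    show φ (A _) = φ (A _) + _ * φ (A _)
    rw [h, hA, hA, hA, hadd, map_mul, hρ, mul_one, map_zpow, hc', Units.inv_mul_cancel_left,
      add_comm]
  · have h := hA 0 a
    rw [zpow_zero, one_mul] at h
    exact congrArg φ h

/-- The characters trivial on `P` that admit a crossed homomorphism which is not principal. -/
theorem exists_crossedHom_iff {ρ : G →* ℂˣ} (hρ : ∀ a, ρ (i a) = 1) :
    (∃ f : G → ℂ, (∀ a b, f (a * b) = f b + ((ρ b)⁻¹ : ℂˣ) * f a) ∧
        ¬ ∃ v : ℂ, ∀ a, f a = v * (((ρ a)⁻¹ : ℂˣ) - 1)) ↔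
      (ρ t : ℂ) = 1 ∨ ∃ φ : P → ℂ, (∀ a b, φ (a * b) = φ a + φ b) ∧ (∃ a, φ a ≠ 0) ∧
        ∀ a, φ (θ a) = ρ t * φ a := by
  constructor
  · rintro ⟨f, hf, hf'⟩
    by_contra! hcon
    obtain ⟨hz, hcon⟩ := hcon
    -- As `ρ` is trivial on `P`, the restriction of `f` is additive, and `f` applied to `θ(a) t = t
    -- a` makes it an eigenfunction for `ρ t`.
    have hfi : ∀ a, f (i a) = 0 := by
      by_contra! h0
      obtain ⟨a, ha⟩ := hcon (fun a => f (i a)) (fun a b => by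
        rw [map_mul, hf, hρ]
        simp [add_comm]) h0
      refine ha ?_
      have h := congrArg f (E.comm a)
      rw [hf, hf, hρ, inv_one, Units.val_one] at h
      have h1 : ((ρ t : ℂˣ) : ℂ) * (((ρ t)⁻¹ : ℂˣ) : ℂ) = 1 := Units.mul_inv _
      linear_combination ((ρ t : ℂˣ) : ℂ) * h - f (i (θ a)) * h1
    have hz' : (((ρ t)⁻¹ : ℂˣ) : ℂ) - 1 ≠ 0 := by
      rw [Units.val_inv_eq_inv_val, sub_ne_zero, ne_eq, inv_eq_one]
      exact hz
    -- The only `v` compatible with principality at `t`; it exists because `ρ t ≠ 1`.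
    set v := f t / ((((ρ t)⁻¹ : ℂˣ) : ℂ) - 1) with hv
    have hvt : f t = v * ((((ρ t)⁻¹ : ℂˣ) : ℂ) - 1) := (div_mul_cancel₀ _ hz').symm
    have key (n : ℤ) : f (t ^ n) = v * ((((ρ (t ^ n))⁻¹ : ℂˣ) : ℂ) - 1) := by
      have h1 : f 1 = 0 := by rw [← map_one i, hfi]
      induction n with
      | zero => simp [h1]
      | succ m ih =>
        rw [zpow_add_one, hf, ih, hvt, map_mul, mul_inv_rev, Units.val_mul]
        ring
      | pred m ih =>
        have h2 := hf (t ^ (-(m : ℤ) - 1)) t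
        have h3 : t ^ (-(m : ℤ) - 1) * t = t ^ (-(m : ℤ)) := by
          rw [zpow_sub_one, inv_mul_cancel_right]
        have h4 : ρ (t ^ (-(m : ℤ))) = ρ (t ^ (-(m : ℤ) - 1)) * ρ t := by rw [← map_mul, h3]
        rw [h3, ih, hvt, h4, mul_inv_rev, Units.val_mul] at h2
        have h5 : (((ρ t)⁻¹ : ℂˣ) : ℂ) ≠ 0 := Units.ne_zero _
        refine mul_left_cancel₀ h5 ?_
        linear_combination -h2
    refine hf' ⟨v, fun g => ?_⟩
    obtain ⟨n, a, rfl⟩ := E.exists_eq_zpow_mul g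
    rw [hf, hfi, key, map_mul, hρ]
    simp
  · rintro (h1 | ⟨φ, hadd, ⟨a, ha⟩, hφ⟩)
    -- Here `ρ` is trivial, so principal crossed homomorphisms vanish, while the degree is `1` at
    -- `t`.
    · obtain ⟨d, hd, hdt, hdi⟩ := E.exists_degree
      have hρ1 : ∀ g, ρ g = 1 := by
        intro g
        obtain ⟨n, a, rfl⟩ := E.exists_eq_zpow_mul g
        have h2 : ρ t = 1 := Units.ext h1
        rw [map_mul, map_zpow, h2, hρ, one_zpow, one_mul]
      refine ⟨d, fun a b => by rw [hd, hρ1, add_comm]; simp, ?_⟩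
      rintro ⟨v, hv⟩
      have h2 := hv t
      rw [hdt, hρ1] at h2
      simp at h2
    · obtain ⟨f, hf, hfφ⟩ := E.exists_crossedHom hρ hadd hφ
      refine ⟨f, hf, ?_⟩
      rintro ⟨v, hv⟩
      refine ha ?_
      rw [← hfφ, hv, hρ]
      simp

end MonodromyExtension

end GroupExtensions

/-! ### Eigenvalues of `h_*` through the fundamental group -/

section Eigenvalues

variable {X : Type} [TopologicalSpace X] [PathConnectedSpace X]

theorem IsCrossed.map_mul {x₀ : X} {F : ∀ x y : FundamentalGroupoid X, (x ⟶ y) → ℂ}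
    (hF : IsCrossed (1 : FundamentalGroup X x₀ →* ℂˣ) F) {x y z : FundamentalGroupoid X}
    (γ : x ⟶ y) (δ : y ⟶ z) : F _ _ (γ ≫ δ) = F _ _ γ + F _ _ δ := by
  rw [hF, transportScalar_one, inv_one, Units.val_one, one_mul]

theorem IsCrossed.map_conj {x₀ : X} {F : ∀ x y : FundamentalGroupoid X, (x ⟶ y) → ℂ}
    (hF : IsCrossed (1 : FundamentalGroup X x₀ →* ℂˣ) F) {x y : FundamentalGroupoid X}
    (γ : x ⟶ x) (δ : x ⟶ y) : F _ _ (Groupoid.inv δ ≫ γ ≫ δ) = F _ _ γ := by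
  have h0 : F _ _ (𝟙 y) = 0 := by
    have h1 := hF.map_mul (𝟙 y) (𝟙 y)
    rw [Category.comp_id] at h1
    linear_combination -h1
  have h2 := hF.map_mul (Groupoid.inv δ) δ
  rw [Groupoid.inv_comp, h0] at h2
  rw [hF.map_mul, hF.map_mul]
  linear_combination -h2

/-- Linear forms on the first homology group restrict to additive functions on the fundamental
group. -/
theorem exists_additive_loopClass (x₀ : X) (ψ : H1 X →ₗ[ℂ] ℂ) :
    ∃ φ : FundamentalGroup X x₀ → ℂ, (∀ a b, φ (a * b) = φ a + φ b) ∧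
      ∀ p : Path x₀ x₀, ψ (loopClass p) = φ (FundamentalGroup.fromArrow p.toHom) := by
  obtain ⟨F, hF, hψ⟩ := exists_isCrossed_loopClass x₀ ψ
  refine ⟨fun a => F _ _ a.toArrow, fun a b => ?_, fun p => hψ p⟩
  rw [add_comm]
  exact hF.map_mul b.toArrow a.toArrow

/-- The form is given by an additive function on the whole fundamental groupoid, so carrying the
loop from `h u` back to `u` along `β` does not change its value. -/
theorem dual_comp_H1map_loopClass (h : X ≃ₜ X) {u : X} (β : Path (h u) u)
    {ψ : H1 X →ₗ[ℂ] ℂ} {φ : FundamentalGroup X u → ℂ}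
    (hψ : ∀ p : Path u u, ψ (loopClass p) = φ (FundamentalGroup.fromArrow p.toHom))
    (p : Path u u) : ψ (H1map (h : C(X, X)) (loopClass p)) =
      φ (MappingTorus.monodromyHom h β (FundamentalGroup.fromArrow p.toHom)) := by
  obtain ⟨F, hF, hψF⟩ := exists_isCrossed_loopClass u ψ
  have hφ (a : FundamentalGroup X u) : φ a = F _ _ a.toArrow := by
    obtain ⟨q, rfl⟩ := exists_path_toHom a.toArrow
    rw [← hψF]
    exact (hψ q).symm
  rw [H1map_loopClass, hψF, hφ, MappingTorus.monodromyHom_toHom]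
  exact (hF.map_conj _ β.toHom).symm

/-- In finite dimension `f - z` fails to be injective exactly when it fails to be surjective, that
is, when a nonzero form kills its range. -/
theorem Module.End.hasEigenvalue_iff_exists_dual {K V : Type*} [Field K] [AddCommGroup V]
    [Module K V] [FiniteDimensional K V] (f : V →ₗ[K] V) (z : K) :
    Module.End.HasEigenvalue f z ↔ ∃ ψ : V →ₗ[K] K, ψ ≠ 0 ∧ ψ ∘ₗ f = z • ψ := by
  rw [Module.End.hasEigenvalue_iff, Module.End.eigenspace_def, ne_eq,
    LinearMap.ker_eq_bot_iff_range_eq_top]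
  constructor
  · intro hr
    obtain ⟨ψ, hψ0, hψ⟩ := Submodule.exists_dual_map_eq_bot_of_lt_top (lt_top_iff_ne_top.mpr hr)
      inferInstance
    refine ⟨ψ, hψ0, LinearMap.ext fun v => ?_⟩
    have h1 : ψ ((f - z • 1) v) ∈ Submodule.map ψ (LinearMap.range (f - z • 1)) :=
      ⟨_, ⟨v, rfl⟩, rfl⟩
    rw [hψ, Submodule.mem_bot, LinearMap.sub_apply, map_sub, sub_eq_zero] at h1
    rw [LinearMap.comp_apply, h1]
    simp
  · rintro ⟨ψ, hψ0, hψ⟩ hr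
    refine hψ0 (LinearMap.ext fun w => ?_)
    obtain ⟨v, rfl⟩ := LinearMap.range_eq_top.mp hr w
    have h1 := LinearMap.congr_fun hψ v
    rw [LinearMap.comp_apply, LinearMap.smul_apply] at h1
    rw [LinearMap.sub_apply, map_sub, h1]
    simp

/-- The eigenvalues in first homology in terms of the fundamental group. -/
theorem hasEigenvalue_H1map_iff [FiniteDimensional ℂ (H1 X)] (h : X ≃ₜ X) {u : X}
    (β : Path (h u) u) (z : ℂ) :
    Module.End.HasEigenvalue (H1map (h : C(X, X))) z ↔
      ∃ φ : FundamentalGroup X u → ℂ, (∀ a b, φ (a * b) = φ a + φ b) ∧ (∃ a, φ a ≠ 0) ∧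
        ∀ a, φ (MappingTorus.monodromyHom h β a) = z * φ a := by
  rw [Module.End.hasEigenvalue_iff_exists_dual]
  constructor
  · rintro ⟨ψ, hψ0, hψ⟩
    obtain ⟨φ, hφ, hψφ⟩ := exists_additive_loopClass u ψ
    refine ⟨φ, hφ, ?_, fun a => ?_⟩
    · by_contra! h0
      exact hψ0 (dual_eq_zero_of_loopClass (x₀ := u) ψ fun p => by rw [hψφ, h0])
    · obtain ⟨p, rfl⟩ := exists_path_toHom a.toArrow
      rw [← dual_comp_H1map_loopClass h β hψφ]
      refine (LinearMap.congr_fun hψ (loopClass p)).trans ?_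
      rw [LinearMap.smul_apply, hψφ, smul_eq_mul]
  · rintro ⟨φ, hφ, ⟨a, ha⟩, hφz⟩
    obtain ⟨ψ, hψ⟩ := exists_dual_loopClass hφ
    refine ⟨ψ, ?_, ?_⟩
    · rintro rfl
      obtain ⟨p, rfl⟩ := exists_path_toHom a.toArrow
      exact ha (hψ p).symm
    · rw [← sub_eq_zero]
      refine dual_eq_zero_of_loopClass (x₀ := u) _ fun p => ?_
      rw [LinearMap.sub_apply, LinearMap.comp_apply, dual_comp_H1map_loopClass h β hψ, hφz,
        LinearMap.smul_apply, hψ, smul_eq_mul, sub_self]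

end Eigenvalues

/-! ### Topology of character groups -/

section CharacterGroups

theorem CharacterGroup.continuous_eval {X : Type} [TopologicalSpace X] {x₀ : X}
    (g : FundamentalGroup X x₀) :
    Continuous fun ρ : CharacterGroup X x₀ => (show FundamentalGroup X x₀ →* ℂˣ from ρ) g :=
  (continuous_apply g).comp continuous_induced_dom

theorem CharacterGroup.continuous_of_eval {X Y : Type} [TopologicalSpace X] [TopologicalSpace Y]
    {x₀ : X} {f : Y → CharacterGroup X x₀}
    (hf : ∀ g, Continuous fun y => (show FundamentalGroup X x₀ →* ℂˣ from f y) g) :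
    Continuous f :=
  continuous_induced_rng.mpr (continuous_pi hf)

theorem CharacterGroup.continuous_pullback {X Y : Type} [TopologicalSpace X] [TopologicalSpace Y]
    (f : C(X, Y)) {x₀ : X} {y₀ : Y} (hf : f x₀ = y₀) :
    Continuous (CharacterGroup.pullback f hf) :=
  CharacterGroup.continuous_of_eval fun g =>
    CharacterGroup.continuous_eval (FundamentalGroup.mapOfEq f hf g)

theorem circleCharacterEval_bijective : Function.Bijective circleCharacterEval := by
  constructor
  · intro χ χ' h
    refine MonoidHom.ext (M := FundamentalGroup UnitAddCircle 0) (N := ℂˣ) fun g => ?_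
    obtain ⟨n, rfl⟩ := exists_circleGenerator_zpow g
    exact (map_zpow (show FundamentalGroup UnitAddCircle 0 →* ℂˣ from χ) _ n).trans
      ((congrArg (· ^ n) h).trans
        (map_zpow (show FundamentalGroup UnitAddCircle 0 →* ℂˣ from χ') _ n).symm)
  · intro z
    exact exists_hom_apply_generator circleGenerator_zpow_injective exists_circleGenerator_zpow z

/-- For the inverse, pointwise convergence only requires continuity of `z ↦ zⁿ`, the value at the
`n`-th power of the generator. -/
theorem isHomeomorph_circleCharacterEval : IsHomeomorph circleCharacterEval := by
  refine isHomeomorph_iff_exists_inverse.mpr ⟨CharacterGroup.continuous_eval circleGenerator,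
    (Equiv.ofBijective _ circleCharacterEval_bijective).symm,
    (Equiv.ofBijective _ circleCharacterEval_bijective).left_inv,
    (Equiv.ofBijective _ circleCharacterEval_bijective).right_inv, ?_⟩
  refine CharacterGroup.continuous_of_eval fun g => ?_
  obtain ⟨n, rfl⟩ := exists_circleGenerator_zpow g
  refine (continuous_zpow n).congr fun z => ?_
  refine Eq.trans ?_ (map_zpow (show FundamentalGroup UnitAddCircle 0 →* ℂˣ from
    (Equiv.ofBijective _ circleCharacterEval_bijective).symm z) circleGenerator n).symm
  exact congrArg (· ^ n) ((Equiv.ofBijective _ circleCharacterEval_bijective).right_inv z).symm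

end CharacterGroups

/-! ### The characters and first cohomology of the mapping torus -/

namespace MappingTorus

variable {X : Type} [TopologicalSpace X] (h : X ≃ₜ X) {u : X}

theorem monodromyExtension (β : Path (h u) u) :
    MonodromyExtension (fiberHom h u) (projHom h u) circleGenerator (monodromyLoop h β)
      (monodromyHom h β) where
  injective := fiberHom_injective h u
  proj_incl := projHom_fiberHom h u
  exact _ := exists_fiberHom_eq_of_projHom_eq_one h u
  zpow_injective := circleGenerator_zpow_injective
  zpow_surjective := exists_circleGenerator_zpow
  proj_lift := projHom_monodromyLoop h β
  comm := fiberHom_monodromyHom_mul h β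

variable [PathConnectedSpace X]

/-- Pullback followed by evaluation at the monodromy loop is evaluation at the generator of the
circle, already a homeomorphism. -/
theorem isEmbedding_projPullback : IsEmbedding (projPullback h u) := by
  have E := monodromyExtension h (PathConnectedSpace.somePath (h u) u)
  refine IsEmbedding.of_comp (CharacterGroup.continuous_pullback _ _)
    (CharacterGroup.continuous_eval (monodromyLoop h (PathConnectedSpace.somePath (h u) u))) ?_
  have hcomp : (fun ρ : CharacterGroup (MappingTorus h) (base h u) =>
      (show FundamentalGroup (MappingTorus h) (base h u) →* ℂˣ from ρ)
        (monodromyLoop h (PathConnectedSpace.somePath (h u) u))) ∘ projPullback h u =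
      circleCharacterEval :=
    funext fun χ => congrArg (show FundamentalGroup UnitAddCircle 0 →* ℂˣ from χ) E.proj_lift
  rw [hcomp]
  exact isHomeomorph_circleCharacterEval.isEmbedding

variable [FiniteDimensional ℂ (H1 X)]
  (hone : ¬ Module.End.HasEigenvalue (H1map (h : C(X, X))) (1 : ℂ))
include hone

theorem additive_eq_zero_of_invariant (β : Path (h u) u) (φ : FundamentalGroup X u → ℂ)
    (hφ : ∀ a b, φ (a * b) = φ a + φ b) (hinv : ∀ a, φ (monodromyHom h β a) = φ a)
    (a : FundamentalGroup X u) : φ a = 0 := by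
  by_contra ha
  exact hone ((hasEigenvalue_H1map_iff h β 1).mpr
    ⟨φ, hφ, ⟨a, ha⟩, fun a => by rw [hinv, one_mul]⟩)

/-- The dual space is spanned by the degree, since an additive function on the extension vanishes on
the fibre group. -/
theorem finrank_H1 : Module.finrank ℂ (H1 (MappingTorus h)) = 1 := by
  obtain ⟨u⟩ : Nonempty X := inferInstance
  let β := PathConnectedSpace.somePath (h u) u
  have E := monodromyExtension h β
  obtain ⟨d, hd, hdt, hdi⟩ := E.exists_degree
  obtain ⟨D, hD⟩ := exists_dual_loopClass hd
  rw [← Subspace.dual_finrank_eq]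
  refine finrank_eq_one D ?_ fun ψ => ?_
  · rintro rfl
    obtain ⟨p, hp⟩ := exists_path_toHom (monodromyLoop h β).toArrow
    have h1 := hD p
    rw [hp, LinearMap.zero_apply] at h1
    exact one_ne_zero (hdt.symm.trans h1.symm)
  · obtain ⟨φ, hφ, hψ⟩ := exists_additive_loopClass (base h u) ψ
    have hφi := additive_eq_zero_of_invariant h hone β (fun a => φ (fiberHom h u a))
      (fun a b => by rw [map_mul, hφ]) fun a => E.conj_invariant hφ a
    refine ⟨φ (monodromyLoop h β), ?_⟩
    rw [← sub_eq_zero]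
    refine dual_eq_zero_of_loopClass (x₀ := base h u) _ fun p => ?_
    rw [LinearMap.sub_apply, LinearMap.smul_apply, hD, hψ, smul_eq_mul,
      E.eq_smul_degree hd hdt hdi hφ hφi (FundamentalGroup.fromArrow p.toHom), sub_self]

theorem range_projPullback :
    Set.range (projPullback h u) = identityComponent (MappingTorus h) (base h u) := by
  let β := PathConnectedSpace.somePath (h u) u
  have E := monodromyExtension h β
  apply subset_antisymm
  -- The range is a connected image of `ℂˣ` containing `1`.
  · let e := isHomeomorph_circleCharacterEval.homeomorph
    have : PreconnectedSpace (CharacterGroup UnitAddCircle 0) :=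
      ⟨e.symm.surjective.range_eq ▸ isPreconnected_range e.symm.continuous⟩
    exact (isPreconnected_range (isEmbedding_projPullback h).continuous).subset_connectedComponent
      ⟨1, map_one _⟩
  · intro χ hχ
    have key (a : FundamentalGroup X u) :
        (show FundamentalGroup (MappingTorus h) (base h u) →* ℂˣ from χ) (fiberHom h u a) = 1 := by
      obtain ⟨n, hn, hpow⟩ := E.exists_pow_eq_one (additive_eq_zero_of_invariant h hone β) a
      let ev : CharacterGroup (MappingTorus h) (base h u) → ℂ := fun ρ =>
        (((show FundamentalGroup (MappingTorus h) (base h u) →* ℂˣ from ρ)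
          (fiberHom h u a) : ℂˣ) : ℂ)
      have hev : Continuous ev :=
        Units.continuous_val.comp (CharacterGroup.continuous_eval (fiberHom h u a))
      have hfin : Set.Finite {z : ℂ | z ^ n = 1} := by
        refine (Polynomial.nthRoots n (1 : ℂ)).toFinset.finite_toSet.subset fun z hz => ?_
        simpa [Polynomial.mem_nthRoots (Nat.pos_of_ne_zero hn)] using hz
      -- Evaluation sends the connected component into the finite set of `n`-th roots of unity, so
      -- it is constant, equal to its value at the trivial character.
      have hsub := hfin.countable.isTotallyDisconnected (ev '' connectedComponent 1)
        (by
          rintro _ ⟨ρ, -, rfl⟩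
          have := congrArg Units.val (hpow ρ)
          simpa [ev] using this)
        (isPreconnected_connectedComponent.image _ hev.continuousOn)
      have := hsub ⟨χ, hχ, rfl⟩ ⟨1, mem_connectedComponent, rfl⟩
      exact Units.ext this
    exact E.exists_comp_eq _ key

theorem image_characteristicVariety :
    (fun χ => (circleCharacterEval χ : ℂ)) '' (projPullback h u ⁻¹'
      (characteristicVariety (MappingTorus h) (base h u) 1 ∩
        identityComponent (MappingTorus h) (base h u))) =
      insert 1 {z : ℂ | Module.End.HasEigenvalue (H1map (h : C(X, X))) z} := by
  let β := PathConnectedSpace.somePath (h u) u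
  have E := monodromyExtension h β
  have key (χ : CharacterGroup UnitAddCircle 0) :
      projPullback h u χ ∈ characteristicVariety (MappingTorus h) (base h u) 1 ↔
        (circleCharacterEval χ : ℂ) = 1 ∨
        Module.End.HasEigenvalue (H1map (h : C(X, X))) (circleCharacterEval χ : ℂ) := by
    let ρ : FundamentalGroup (MappingTorus h) (base h u) →* ℂˣ :=
      MonoidHom.comp (show FundamentalGroup UnitAddCircle 0 →* ℂˣ from χ) (projHom h u)
    have h1 : ρ (monodromyLoop h β) = circleCharacterEval χ :=
      congrArg (show FundamentalGroup UnitAddCircle 0 →* ℂˣ from χ) E.proj_lift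
    have h2 (a) : ρ (fiberHom h u a) = 1 := by
      rw [MonoidHom.comp_apply, E.proj_incl, map_one]
    rw [hasEigenvalue_H1map_iff h β, ← h1, ← E.exists_crossedHom_iff h2,
      ← one_le_rank_twistedH1_iff]
    show ((1 : ℕ) : Cardinal) ≤ _ ↔ _
    rw [Nat.cast_one]
    rfl
  ext z
  constructor
  · rintro ⟨χ, ⟨hχ, -⟩, rfl⟩
    exact (key χ).mp hχ
  · intro hz
    -- Zero is not an eigenvalue because `θ` is surjective.
    have hz0 : z ≠ 0 := by
      rintro rfl
      rcases hz with hz | hz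
      · exact zero_ne_one hz
      · obtain ⟨φ, -, ⟨b, hb⟩, hφ⟩ := (hasEigenvalue_H1map_iff h β 0).mp hz
        obtain ⟨a, rfl, -⟩ := E.exists_comm b
        exact hb (by rw [hφ, zero_mul])
    obtain ⟨χ, hχ⟩ := circleCharacterEval_bijective.2 (Units.mk0 z hz0)
    have hχ' : (circleCharacterEval χ : ℂ) = z := by rw [hχ, Units.val_mk0]
    refine ⟨χ, ⟨(key χ).mpr (by rw [hχ']; exact hz), ?_⟩, hχ'⟩
    rw [← range_projPullback h hone]
    exact ⟨χ, rfl⟩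

end MappingTorus

end

theorem mainTheorem5 {U : Type} [TopologicalSpace U] [T2Space U] [CompactSpace U]
    [ConnectedSpace U] [ChartedSpace ℂ U] [IsManifold 𝓘(ℂ) ω U]
    (hgenus : 1 ≤ genus U)
    (h : U ≃ₘ^∞⟮𝓘(ℝ, ℂ), 𝓘(ℝ, ℂ)⟯ U)
    (horient : OrientationPreserving h)
    (hone : ¬ Module.End.HasEigenvalue (H1map (h.toHomeomorph : C(U, U))) (1 : ℂ))
    (u : U) :
    -- the first Betti number of the mapping torus is one
    Module.finrank ℂ (H1 (MappingTorus h.toHomeomorph)) = 1 ∧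
    -- evaluation at the standard generator identifies `𝕋(S¹)` with `ℂ*`
    IsHomeomorph circleCharacterEval ∧
    -- `p^*` identifies `𝕋(S¹)` with the identity component of `𝕋(U_h)`
    IsEmbedding (MappingTorus.projPullback h.toHomeomorph u) ∧
    Set.range (MappingTorus.projPullback h.toHomeomorph u) =
      identityComponent (MappingTorus h.toHomeomorph) (MappingTorus.base h.toHomeomorph u) ∧
    -- the subset of `ℂ*` that corresponds to `𝒱₁(U_h) ∩ 𝕋⁰(U_h)`
    (fun χ => (circleCharacterEval χ : ℂ)) ''
        (MappingTorus.projPullback h.toHomeomorph u ⁻¹'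
          (characteristicVariety (MappingTorus h.toHomeomorph)
              (MappingTorus.base h.toHomeomorph u) 1 ∩
            identityComponent (MappingTorus h.toHomeomorph)
              (MappingTorus.base h.toHomeomorph u))) =
      insert 1 {z : ℂ | Module.End.HasEigenvalue (H1map (h.toHomeomorph : C(U, U))) z} := by
  have : FiniteDimensional ℂ (H1 U) := by
    -- `finrank` is `0` in infinite dimension, so positive genus forces `H₁(U; ℂ)` to be
    -- finite-dimensional.
    refine Module.finite_of_finrank_pos ?_
    have : 1 ≤ Module.finrank ℂ (H1 U) / 2 := hgenus
    omega
  exact ⟨MappingTorus.finrank_H1 _ hone, isHomeomorph_circleCharacterEval,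
    MappingTorus.isEmbedding_projPullback _, MappingTorus.range_projPullback _ hone,
    MappingTorus.image_characteristicVariety _ hone⟩
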